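/- A *Waldhausen category* is a category $\mathbf C$ with a distinguished zero object $*$, a class of cofibrations $\rightarrowtail$ and a class of weak equivalences $\xrightarrow{\sim}$, both containing all isomorphisms and closed under composition, such that $*\to A$ is always a cofibration, pushouts along cofibrations exist, cobase changes of cofibrations are cofibrations, and weak equivalences satisfy the gluing axiom. A *cofiber sequence* $A\rightarrowtail B\twoheadrightarrow B/A$ consists of a cofibration $A\rightarrowtail B$ and a pushout $B\twoheadrightarrow B/A$ of $A\to *$ along it. A *stable quadratic module* $C_*$ consists of homomorphisms of (not necessarily abelian, additively written) groups $$C_0^{ab}\otimes C_0^{ab}\xrightarrow{\langle\cdot,\cdot\rangle}C_1\xrightarrow{\partial}C_0$$ with $\partial\langle c_0,d_0\rangle=[d_0,c_0]$, $\langle\partial c_1,\partial d_1\rangle=[d_1,c_1]$ and $\langle c_0,d_0\rangle+\langle d_0,c_0\rangle=0$, where $[x,y]=-x-y+x+y$. Write $c_1^{c_0}=c_1+\langle c_0,\partial c_1\rangle$. For a Waldhausen category $\mathbf C$, let $\mathcal D_*\mathbf C$ be the stable quadratic module generated in degree $0$ by the symbols $[A]$ for all objects $A$, and in degree $1$ by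 the symbols $[A\xrightarrow{\sim}A']$ for all weak equivalences and $[A\rightarrowtail B\twoheadrightarrow B/A]$ for all cofiber sequences, subject to the relations: 1. $\partial[A\xrightarrow{\sim}A']=-[A']+[A]$. 2. $\partial[A\rightarrowtail B\twoheadrightarrow B/A]=-[B]+[B/A]+[A]$. 3. $[*]=0$. 4. $[A\xrightarrow{1_A}A]=0$. 5. $[A\xrightarrow{1_A}A\twoheadrightarrow *]=0$ and $[*\rightarrowtail A\xrightarrow{1_A}A]=0$. 6. $[A\xrightarrow{\sim}C]=[B\xrightarrow{\sim}C]+[A\xrightarrow{\sim}B]$ for composable weak equivalences $A\xrightarrow{\sim}B\xrightarrow{\sim}C$. 7. For every commutative diagram given by cofiber sequences $A\rightarrowtail B\twoheadrightarrow B/A$ and $A'\rightarrowtail B'\twoheadrightarrow B'/A'$ and weak equivalences $A\xrightarrow{\sim}A'$, $B\xrightarrow{\sim}B'$, $B/A\xrightarrow{\sim}B'/A'$ between them, $$[A\xrightarrow{\sim}A']+[B/A\xrightarrow{\sim}B'/A']^{[A]}=-[A'\rightarrowtail B'\twoheadrightarrow B'/A']+[B\xrightarrow{\sim}B']+[A\rightarrowtail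 B\twoheadrightarrow B/A].$$ 8. For composable cofibrations $A\rightarrowtail B\rightarrowtail C$ and every commutative diagram formed by four cofiber sequences $A\rightarrowtail B\twoheadrightarrow B/A$, $A\rightarrowtail C\twoheadrightarrow C/A$, $B\rightarrowtail C\twoheadrightarrow C/B$ and $B/A\rightarrowtail C/A\twoheadrightarrow C/B$, $$[B\rightarrowtail C\twoheadrightarrow C/B]+[A\rightarrowtail B\twoheadrightarrow B/A]=[A\rightarrowtail C\twoheadrightarrow C/A]+[B/A\rightarrowtail C/A\twoheadrightarrow C/B]^{[A]}.$$ 9. For all objects $A,B$ and every coproduct $A\vee B$ with inclusions $i_1,i_2$ and projections $p_1,p_2$, $$\langle[A],[B]\rangle=-[B\overset{i_2}{\rightarrowtail}A\vee B\overset{p_1}{\twoheadrightarrow}A]+[A\overset{i_1}{\rightarrowtail}A\vee B\overset{p_2}{\twoheadrightarrow}B].$$ Put $K_1\mathbf C=\ker(\partial\colon\mathcal D_1\mathbf C\to\mathcal D_0\mathbf C)$. A *weak cofiber sequence* $A\rightarrowtail B\twoheadrightarrow C_1\xleftarrow{\sim}C$ is a cofiber sequence $A\rightarrowtail B\twoheadrightarrow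 C_1$ together with a weak equivalence $C\xrightarrow{\sim}C_1$; its class in $\mathcal D_1\mathbf C$ is $$[A\rightarrowtail B\twoheadrightarrow C_1\xleftarrow{\sim}C]=[A\rightarrowtail B\twoheadrightarrow C_1]+[C\xrightarrow{\sim}C_1]^{[A]}.$$ A *pair of weak cofiber sequences* consists of two weak cofiber sequences $\ell_i=(A\rightarrowtail B\twoheadrightarrow C_i\xleftarrow{\sim}C)$, $i=1,2$, with the same objects $A$, $B$, $C$; it represents the element $-[\ell_1]+[\ell_2]$, which lies in $K_1\mathbf C$. **Theorem.** For every Waldhausen category $\mathbf C$, every element of $K_1\mathbf C$ is represented by a pair of weak cofiber sequences. -/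

import Mathlib

open CategoryTheory CategoryTheory.Limits

universe u v u₀ u₁ w₀ w₁

/-! ## Waldhausen categories -/

/-- A Waldhausen category: a category with a distinguished zero object `*`, a class of
cofibrations and a class of weak equivalences, both containing the isomorphisms and closed under
composition, such that `* ⟶ A` is always a cofibration, pushouts along cofibrations exist, a
cobase change of a cofibration is a cofibration, and the gluing axiom holds. -/
class WaldhausenCategory (C : Type u) [Category.{v} C] where
  /-- the distinguished zero object -/
  zeroObj : C
  isZero_zeroObj : IsZero zeroObj
  /-- the cofibrations -/
  cof : MorphismProperty C
  /-- the weak equivalences -/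
  weq : MorphismProperty C
  cof_of_isIso : ∀ {A B : C} (f : A ⟶ B), IsIso f → cof f
  cof_comp : ∀ {A B X : C} (f : A ⟶ B) (g : B ⟶ X), cof f → cof g → cof (f ≫ g)
  cof_zero : ∀ A : C, cof (isZero_zeroObj.to_ A)
  hasPushout : ∀ {A B X : C} (i : A ⟶ B) (f : A ⟶ X), cof i → HasPushout i f
  cof_cobaseChange : ∀ {A B X P : C} {i : A ⟶ B} {f : A ⟶ X} {g : B ⟶ P} {j : X ⟶ P},
    IsPushout i f g j → cof i → cof j
  weq_of_isIso : ∀ {A B : C} (f : A ⟶ B), IsIso f → weq f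
  weq_comp : ∀ {A B X : C} (f : A ⟶ B) (g : B ⟶ X), weq f → weq g → weq (f ≫ g)
  gluing : ∀ {A B X P A' B' X' P' : C}
    {i : A ⟶ B} {f : A ⟶ X} {g : B ⟶ P} {j : X ⟶ P}
    {i' : A' ⟶ B'} {f' : A' ⟶ X'} {g' : B' ⟶ P'} {j' : X' ⟶ P'}
    (a : A ⟶ A') (b : B ⟶ B') (x : X ⟶ X') (p : P ⟶ P'),
    IsPushout i f g j → IsPushout i' f' g' j' → cof i → cof i' →
    weq a → weq b → weq x →
    i ≫ b = a ≫ i' → f ≫ x = a ≫ f' → g ≫ p = b ≫ g' → j ≫ p = x ≫ j' →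
    weq p

namespace WaldhausenCategory

section
variable {C : Type u} [Category.{v} C] [WaldhausenCategory C]

/-- The unique map `A ⟶ *`. -/
noncomputable def toZero (A : C) : A ⟶ zeroObj (C := C) := isZero_zeroObj.from_ A

/-- The unique map `* ⟶ A`. -/
noncomputable def fromZero (A : C) : zeroObj (C := C) ⟶ A := isZero_zeroObj.to_ A

/-- `A ⟶ B ⟶ Q` is a cofiber sequence: `i` is a cofibration and `Q` is the pushout of
`B ⟵ A ⟶ *`, with `q` the structure map from `B`. -/
def IsCofiberSeq {A B Q : C} (i : A ⟶ B) (q : B ⟶ Q) : Prop :=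
  cof i ∧ IsPushout i (toZero A) q (fromZero Q)

theorem weq_id (A : C) : weq (𝟙 A) := weq_of_isIso _ inferInstance

/-- `A ⟶ A ⟶ *` is a cofiber sequence. -/
theorem isCofiberSeq_id_toZero (A : C) : IsCofiberSeq (𝟙 A) (toZero A) := by
  have h : fromZero (zeroObj (C := C)) = 𝟙 _ := isZero_zeroObj.eq_of_src _ _
  refine ⟨cof_of_isIso _ inferInstance, ?_⟩
  rw [h]
  exact IsPushout.of_horiz_isIso ⟨by simp⟩

/-- `* ⟶ A ⟶ A` is a cofiber sequence. -/
theorem isCofiberSeq_fromZero_id (A : C) : IsCofiberSeq (fromZero A) (𝟙 A) := by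
  have h : toZero (zeroObj (C := C)) = 𝟙 _ := isZero_zeroObj.eq_of_src _ _
  refine ⟨cof_zero A, ?_⟩
  rw [h]
  exact IsPushout.of_vert_isIso ⟨by simp⟩

/-- `S` is a coproduct `A ∨ B` with inclusions `i₁`, `i₂` and projections `p₁`, `p₂`. -/
structure IsCoproductDiagram {A B S : C} (i₁ : A ⟶ S) (i₂ : B ⟶ S) (p₁ : S ⟶ A) (p₂ : S ⟶ B) :
    Prop where
  isColimit : Nonempty (IsColimit (BinaryCofan.mk i₁ i₂))
  inl_fst : i₁ ≫ p₁ = 𝟙 A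
  inr_fst : i₂ ≫ p₁ = toZero B ≫ fromZero A
  inl_snd : i₁ ≫ p₂ = toZero A ≫ fromZero B
  inr_snd : i₂ ≫ p₂ = 𝟙 B

theorem IsCoproductDiagram.symm {A B S : C} {i₁ : A ⟶ S} {i₂ : B ⟶ S} {p₁ : S ⟶ A} {p₂ : S ⟶ B}
    (h : IsCoproductDiagram i₁ i₂ p₁ p₂) : IsCoproductDiagram i₂ i₁ p₂ p₁ where
  isColimit := ⟨BinaryCofan.isColimitFlip h.isColimit.some⟩
  inl_fst := h.inr_snd
  inr_fst := h.inl_snd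
  inl_snd := h.inr_fst
  inr_snd := h.inl_fst

/-- `A ⟶ A ∨ B ⟶ B` is a cofiber sequence. -/
theorem IsCoproductDiagram.isCofiberSeq {A B S : C} {i₁ : A ⟶ S} {i₂ : B ⟶ S} {p₁ : S ⟶ A}
    {p₂ : S ⟶ B} (h : IsCoproductDiagram i₁ i₂ p₁ p₂) : IsCofiberSeq i₁ p₂ := by
  have h1 : isZero_zeroObj.isInitial.to B = fromZero B := isZero_zeroObj.eq_of_src _ _
  have h2 : isZero_zeroObj.isInitial.to A = fromZero A := isZero_zeroObj.eq_of_src _ _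
  have hS : IsPushout (fromZero B) (fromZero A) i₂ i₁ := by
    have k := IsPushout.of_isColimit_binaryCofan_of_isInitial
      h.isColimit.some isZero_zeroObj.isInitial
    rw [← h1, ← h2]
    exact k
  refine ⟨cof_cobaseChange hS (cof_zero B), ?_⟩
  have hid : fromZero A ≫ toZero A = 𝟙 _ := isZero_zeroObj.eq_of_src _ _
  have hbig : IsPushout (fromZero B) (fromZero A ≫ toZero A) (i₂ ≫ p₂) (fromZero B) := by
    rw [h.inr_snd, hid]
    exact IsPushout.of_vert_isIso ⟨by simp⟩
  exact IsPushout.of_left (hbig.flip) h.inl_snd.symm hS.flip |>.flip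
end

end WaldhausenCategory

/-! ## Stable quadratic modules -/

/-- The commutator `[x, y] = -x - y + x + y`, in additive notation. -/
def addComm {G : Type*} [AddGroup G] (x y : G) : G := -x + -y + x + y

set_option linter.checkUnivs false in
/-- A stable quadratic module. The groups are written additively but need not be commutative.
A homomorphism `C₀ᵃᵇ ⊗ C₀ᵃᵇ → C₁` is the same thing as a function `C₀ → C₀ → C₁` additive in each
variable: expanding `⟨a + b, c + d⟩` in two ways shows that the values of such a function commute
with each other, hence that it vanishes on commutators (see the two lemmas below). -/
structure StableQuadraticModule where
  C₀ : Type u₀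
  C₁ : Type u₁
  [addGroup₀ : AddGroup C₀]
  [addGroup₁ : AddGroup C₁]
  bracket : C₀ → C₀ → C₁
  bracket_add_left : ∀ a b c : C₀, bracket (a + b) c = bracket a c + bracket b c
  bracket_add_right : ∀ a b c : C₀, bracket a (b + c) = bracket a b + bracket a c
  bd : C₁ →+ C₀
  bd_bracket : ∀ c d : C₀, bd (bracket c d) = addComm d c
  bracket_bd : ∀ c d : C₁, bracket (bd c) (bd d) = addComm d c
  bracket_antisymm : ∀ c d : C₀, bracket c d + bracket d c = 0

namespace StableQuadraticModule

attribute [instance] addGroup₀ addGroup₁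

section
variable (M : StableQuadraticModule.{u₀, u₁})

theorem bracket_commute (a b c d : M.C₀) :
    M.bracket a c + M.bracket b d = M.bracket b d + M.bracket a c := by
  have h : M.bracket (b + a) c + M.bracket (b + a) d =
      M.bracket b (c + d) + M.bracket a (c + d) := by
    rw [← M.bracket_add_right, M.bracket_add_left]
  simp only [M.bracket_add_left, M.bracket_add_right, add_assoc, add_right_inj] at h
  simpa only [← add_assoc, add_left_inj] using h

theorem bracket_zero_left (c : M.C₀) : M.bracket 0 c = 0 := by
  have h := M.bracket_add_left 0 0 c
  simpa using h

theorem bracket_neg_left (a c : M.C₀) : M.bracket (-a) c = - M.bracket a c := by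
  have h := M.bracket_add_left (-a) a c
  rw [neg_add_cancel, bracket_zero_left] at h
  exact eq_neg_of_add_eq_zero_left h.symm

theorem bracket_addComm_left (a b c : M.C₀) : M.bracket (addComm a b) c = 0 := by
  have h := M.bracket_commute a b c c
  simp only [addComm, bracket_add_left, bracket_neg_left, add_assoc]
  rw [h]
  simp

theorem bracket_addComm_right (a b c : M.C₀) : M.bracket c (addComm a b) = 0 := by
  have h := M.bracket_antisymm c (addComm a b)
  simpa [bracket_addComm_left] using h

variable {M}

/-- The right action of `C₀` on `C₁`: `c₁ ^ c₀ = c₁ + ⟨c₀, ∂ c₁⟩`. -/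
def act (c₁ : M.C₁) (c₀ : M.C₀) : M.C₁ := c₁ + M.bracket c₀ (M.bd c₁)

theorem bd_act (c₁ : M.C₁) (c₀ : M.C₀) : M.bd (act c₁ c₀) = -c₀ + M.bd c₁ + c₀ := by
  simp [act, M.bd_bracket, addComm, ← add_assoc]

/-- The kernel of `∂` is central. -/
theorem add_comm_of_bd_eq_zero {x : M.C₁} (hx : M.bd x = 0) (y : M.C₁) : x + y = y + x := by
  have h := M.bracket_bd x y
  rw [hx, bracket_zero_left] at h
  have h2 : -(x + y) + (y + x) = 0 := by
    have : addComm y x = 0 := h.symm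
    simp only [addComm] at this
    rw [neg_add_rev, ← add_assoc]
    exact this
  exact (neg_add_eq_zero.mp h2)

/-- A morphism of stable quadratic modules. -/
@[ext]
structure Hom (M : StableQuadraticModule.{u₀, u₁}) (N : StableQuadraticModule.{w₀, w₁}) where
  f₀ : M.C₀ →+ N.C₀
  f₁ : M.C₁ →+ N.C₁
  comm_bd : ∀ x, N.bd (f₁ x) = f₀ (M.bd x)
  comm_bracket : ∀ a b, f₁ (M.bracket a b) = N.bracket (f₀ a) (f₀ b)
end

/-! ### Presentations of stable quadratic modules by generators and relations -/

section
variable (E₀ : Type u₀) (E₁ : Type u₁)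

/-- Words in degree `0`: the free group on the symbols `e₀` and `∂ e₁`. -/
abbrev Word₀ := FreeAddGroup (E₀ ⊕ E₁)

/-- Words in degree `1`: the free group on the symbols `e₁` and `⟨a, b⟩`, where `a` and `b` are
words in degree `0`. -/
abbrev Word₁ := FreeAddGroup (E₁ ⊕ (Word₀ E₀ E₁ × Word₀ E₀ E₁))
end

section
variable {E₀ : Type u₀} {E₁ : Type u₁}

/-- The word `e₀`. -/
def Word₀.gen (e : E₀) : Word₀ E₀ E₁ := FreeAddGroup.of (Sum.inl e)

/-- The word `e₁`. -/
def Word₁.gen (e : E₁) : Word₁ E₀ E₁ := FreeAddGroup.of (Sum.inl e)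

/-- The word `⟨a, b⟩`. -/
def Word₁.bracket (a b : Word₀ E₀ E₁) : Word₁ E₀ E₁ := FreeAddGroup.of (Sum.inr (a, b))

/-- The boundary of a word: `e₁ ↦ ∂ e₁` and `⟨a, b⟩ ↦ [b, a]`. -/
def Word₁.bd : Word₁ E₀ E₁ →+ Word₀ E₀ E₁ :=
  FreeAddGroup.lift
    (Sum.elim (fun e => FreeAddGroup.of (Sum.inr e)) (fun p => addComm p.2 p.1))

/-- The word `x ^ a = x + ⟨a, ∂ x⟩`. -/
def Word₁.act (x : Word₁ E₀ E₁) (a : Word₀ E₀ E₁) : Word₁ E₀ E₁ :=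
  x + Word₁.bracket a (Word₁.bd x)

/-- The equations in degree `1` which are imposed: the laws of a stable quadratic module and
the given relations `R₁`. -/
inductive BasicRel₁ (R₁ : Word₁ E₀ E₁ → Word₁ E₀ E₁ → Prop) : Word₁ E₀ E₁ → Word₁ E₀ E₁ → Prop
  | add_left (a b c : Word₀ E₀ E₁) : BasicRel₁ R₁
      (Word₁.bracket (a + b) c) (Word₁.bracket a c + Word₁.bracket b c)
  | add_right (a b c : Word₀ E₀ E₁) : BasicRel₁ R₁
      (Word₁.bracket a (b + c)) (Word₁.bracket a b + Word₁.bracket a c)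
  | bracket_bd (x y : Word₁ E₀ E₁) : BasicRel₁ R₁
      (Word₁.bracket (Word₁.bd x) (Word₁.bd y)) (addComm y x)
  | antisymm (a b : Word₀ E₀ E₁) : BasicRel₁ R₁
      (Word₁.bracket a b + Word₁.bracket b a) 0
  | rel (x y : Word₁ E₀ E₁) : R₁ x y → BasicRel₁ R₁ x y

/-- The equations in degree `0`: the given relations `R₀` and the boundaries of the equations in
degree `1`. -/
inductive Rel₀ (R₀ : Word₀ E₀ E₁ → Word₀ E₀ E₁ → Prop)
    (R₁ : Word₁ E₀ E₁ → Word₁ E₀ E₁ → Prop) : Word₀ E₀ E₁ → Word₀ E₀ E₁ → Prop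
  | rel (a b : Word₀ E₀ E₁) : R₀ a b → Rel₀ R₀ R₁ a b
  | bd (x y : Word₁ E₀ E₁) : BasicRel₁ R₁ x y → Rel₀ R₀ R₁ (Word₁.bd x) (Word₁.bd y)

/-- Equality of words in degree `0`: the congruence generated by `Rel₀`. -/
def con₀ (R₀ : Word₀ E₀ E₁ → Word₀ E₀ E₁ → Prop) (R₁ : Word₁ E₀ E₁ → Word₁ E₀ E₁ → Prop) :
    AddCon (Word₀ E₀ E₁) := addConGen (Rel₀ R₀ R₁)

/-- All equations in degree `1`: those of `BasicRel₁`, and `⟨a, b⟩ = ⟨a', b'⟩` whenever `a = a'`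
and `b = b'` in degree `0`. -/
inductive Rel₁ (R₀ : Word₀ E₀ E₁ → Word₀ E₀ E₁ → Prop)
    (R₁ : Word₁ E₀ E₁ → Word₁ E₀ E₁ → Prop) : Word₁ E₀ E₁ → Word₁ E₀ E₁ → Prop
  | basic (x y : Word₁ E₀ E₁) : BasicRel₁ R₁ x y → Rel₁ R₀ R₁ x y
  | congr (a a' b b' : Word₀ E₀ E₁) : con₀ R₀ R₁ a a' → con₀ R₀ R₁ b b' →
      Rel₁ R₀ R₁ (Word₁.bracket a b) (Word₁.bracket a' b')

/-- Equality of words in degree `1`: the congruence generated by `Rel₁`. -/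
def con₁ (R₀ : Word₀ E₀ E₁ → Word₀ E₀ E₁ → Prop) (R₁ : Word₁ E₀ E₁ → Word₁ E₀ E₁ → Prop) :
    AddCon (Word₁ E₀ E₁) := addConGen (Rel₁ R₀ R₁)

theorem Word₁.bd_gen (e : E₁) :
    Word₁.bd (Word₁.gen e : Word₁ E₀ E₁) = FreeAddGroup.of (Sum.inr e) := by
  simp [Word₁.bd, Word₁.gen]

theorem Word₁.bd_bracket (a b : Word₀ E₀ E₁) :
    Word₁.bd (Word₁.bracket a b) = addComm b a := by
  simp [Word₁.bd, Word₁.bracket]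

theorem con₁_le_bd (R₀ : Word₀ E₀ E₁ → Word₀ E₀ E₁ → Prop)
    (R₁ : Word₁ E₀ E₁ → Word₁ E₀ E₁ → Prop) :
    con₁ R₀ R₁ ≤ AddCon.ker ((con₀ R₀ R₁).mk'.comp (Word₁.bd (E₀ := E₀) (E₁ := E₁))) := by
  refine AddCon.addConGen_le.2 ?_
  intro x y h
  rw [AddCon.ker_rel]
  change (con₀ R₀ R₁).mk' _ = (con₀ R₀ R₁).mk' _
  cases h with
  | basic x y h => exact (AddCon.eq _).2 (AddConGen.Rel.of _ _ (Rel₀.bd x y h))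
  | congr a a' b b' ha hb =>
    have ha' : (con₀ R₀ R₁).mk' a = (con₀ R₀ R₁).mk' a' := (AddCon.eq _).2 ha
    have hb' : (con₀ R₀ R₁).mk' b = (con₀ R₀ R₁).mk' b' := (AddCon.eq _).2 hb
    have hn : ∀ z, (con₀ R₀ R₁).mk' (-z) = - (con₀ R₀ R₁).mk' z := fun _ => rfl
    rw [Word₁.bd_bracket, Word₁.bd_bracket]
    simp only [addComm, map_add, hn, ha', hb']

/-- The stable quadratic module presented by the generators `E₀`, `E₁` and the relations
`R₀`, `R₁` in degrees `0` and `1`. -/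
def presented (R₀ : Word₀ E₀ E₁ → Word₀ E₀ E₁ → Prop)
    (R₁ : Word₁ E₀ E₁ → Word₁ E₀ E₁ → Prop) :
    StableQuadraticModule.{max u₀ u₁, max u₀ u₁} where
  C₀ := (con₀ R₀ R₁).Quotient
  C₁ := (con₁ R₀ R₁).Quotient
  bracket := Quotient.map₂ (Word₁.bracket (E₀ := E₀) (E₁ := E₁))
    (fun a a' ha b b' hb => AddConGen.Rel.of _ _ (Rel₁.congr a a' b b' ha hb))
  bracket_add_left := by
    rintro ⟨a⟩ ⟨b⟩ ⟨c⟩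
    exact (AddCon.eq (con₁ R₀ R₁)).2
      (AddConGen.Rel.of _ _ (Rel₁.basic _ _ (BasicRel₁.add_left a b c)))
  bracket_add_right := by
    rintro ⟨a⟩ ⟨b⟩ ⟨c⟩
    exact (AddCon.eq (con₁ R₀ R₁)).2
      (AddConGen.Rel.of _ _ (Rel₁.basic _ _ (BasicRel₁.add_right a b c)))
  bd := (con₁ R₀ R₁).lift ((con₀ R₀ R₁).mk'.comp Word₁.bd) (con₁_le_bd R₀ R₁)
  bd_bracket := by
    rintro ⟨a⟩ ⟨b⟩
    exact congrArg (con₀ R₀ R₁).mk' (Word₁.bd_bracket a b)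
  bracket_bd := by
    rintro ⟨x⟩ ⟨y⟩
    exact (AddCon.eq (con₁ R₀ R₁)).2
      (AddConGen.Rel.of _ _ (Rel₁.basic _ _ (BasicRel₁.bracket_bd x y)))
  bracket_antisymm := by
    rintro ⟨a⟩ ⟨b⟩
    exact (AddCon.eq (con₁ R₀ R₁)).2
      (AddConGen.Rel.of _ _ (Rel₁.basic _ _ (BasicRel₁.antisymm a b)))

section
variable (R₀ : Word₀ E₀ E₁ → Word₀ E₀ E₁ → Prop) (R₁ : Word₁ E₀ E₁ → Word₁ E₀ E₁ → Prop)

/-- The element of the presented stable quadratic module given by a word in degree `0`. -/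
def mk₀ : Word₀ E₀ E₁ →+ (presented R₀ R₁).C₀ := (con₀ R₀ R₁).mk'

/-- The element of the presented stable quadratic module given by a word in degree `1`. -/
def mk₁ : Word₁ E₀ E₁ →+ (presented R₀ R₁).C₁ := (con₁ R₀ R₁).mk'

variable {R₀ R₁}

theorem bd_mk₁ (x : Word₁ E₀ E₁) :
    (presented R₀ R₁).bd (mk₁ R₀ R₁ x) = mk₀ R₀ R₁ (Word₁.bd x) := rfl

theorem bracket_mk₀ (a b : Word₀ E₀ E₁) :
    (presented R₀ R₁).bracket (mk₀ R₀ R₁ a) (mk₀ R₀ R₁ b) = mk₁ R₀ R₁ (Word₁.bracket a b) := rfl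

theorem mk₀_eq {a b : Word₀ E₀ E₁} (h : R₀ a b) : mk₀ R₀ R₁ a = mk₀ R₀ R₁ b :=
  (AddCon.eq (con₀ R₀ R₁)).2 (AddConGen.Rel.of _ _ (Rel₀.rel a b h))

theorem mk₁_eq {x y : Word₁ E₀ E₁} (h : R₁ x y) : mk₁ R₀ R₁ x = mk₁ R₀ R₁ y :=
  (AddCon.eq (con₁ R₀ R₁)).2 (AddConGen.Rel.of _ _ (Rel₁.basic _ _ (BasicRel₁.rel x y h)))

variable {M : StableQuadraticModule.{w₀, w₁}} (g₀ : E₀ → M.C₀) (g₁ : E₁ → M.C₁)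

/-- Evaluation of words of degree `0` in a stable quadratic module. -/
def eval₀ : Word₀ E₀ E₁ →+ M.C₀ := FreeAddGroup.lift (Sum.elim g₀ (fun e => M.bd (g₁ e)))

/-- Evaluation of words of degree `1` in a stable quadratic module. -/
def eval₁ : Word₁ E₀ E₁ →+ M.C₁ :=
  FreeAddGroup.lift
    (Sum.elim g₁ (fun p => M.bracket (eval₀ g₀ g₁ p.1) (eval₀ g₀ g₁ p.2)))

theorem eval₁_bracket (a b : Word₀ E₀ E₁) :
    eval₁ g₀ g₁ (Word₁.bracket a b) = M.bracket (eval₀ g₀ g₁ a) (eval₀ g₀ g₁ b) := by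
  simp [eval₁, Word₁.bracket]

theorem bd_eval₁ (x : Word₁ E₀ E₁) : M.bd (eval₁ g₀ g₁ x) = eval₀ g₀ g₁ (Word₁.bd x) := by
  have h : M.bd.comp (eval₁ g₀ g₁) = (eval₀ g₀ g₁).comp Word₁.bd := by
    ext e
    rcases e with e | ⟨a, b⟩
    · simp [eval₁, eval₀, Word₁.bd]
    · simp [eval₁, Word₁.bd, M.bd_bracket, addComm]
  exact DFunLike.congr_fun h x

/-- The universal property of the presented stable quadratic module. -/
theorem presented_universal
    (h₀ : ∀ a b, R₀ a b → eval₀ g₀ g₁ a = eval₀ g₀ g₁ b)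
    (h₁ : ∀ x y, R₁ x y → eval₁ g₀ g₁ x = eval₁ g₀ g₁ y) :
    ∃! F : Hom (presented R₀ R₁) M,
      (∀ e, F.f₀ (mk₀ R₀ R₁ (Word₀.gen e)) = g₀ e) ∧
      (∀ e, F.f₁ (mk₁ R₀ R₁ (Word₁.gen e)) = g₁ e) := by
  have hb : ∀ x y, BasicRel₁ R₁ x y → eval₁ g₀ g₁ x = eval₁ g₀ g₁ y := by
    intro x y h
    cases h with
    | add_left a b c => simp [eval₁_bracket, M.bracket_add_left]
    | add_right a b c => simp [eval₁_bracket, M.bracket_add_right]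
    | bracket_bd x y => simp [eval₁_bracket, ← bd_eval₁, M.bracket_bd, addComm]
    | antisymm a b => simp [eval₁_bracket, M.bracket_antisymm]
    | rel x y h => exact h₁ _ _ h
  have H₀ : con₀ R₀ R₁ ≤ AddCon.ker (eval₀ g₀ g₁) := by
    refine AddCon.addConGen_le.2 ?_
    intro x y h
    rw [AddCon.ker_rel]
    cases h with
    | rel a b h => exact h₀ _ _ h
    | bd x y h => rw [← bd_eval₁, ← bd_eval₁, hb _ _ h]
  have H₁ : con₁ R₀ R₁ ≤ AddCon.ker (eval₁ g₀ g₁) := by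
    refine AddCon.addConGen_le.2 ?_
    intro x y h
    rw [AddCon.ker_rel]
    cases h with
    | basic x y h => exact hb _ _ h
    | congr a a' b b' ha hb' =>
      have e1 : eval₀ g₀ g₁ a = eval₀ g₀ g₁ a' := H₀ ha
      have e2 : eval₀ g₀ g₁ b = eval₀ g₀ g₁ b' := H₀ hb'
      rw [eval₁_bracket, eval₁_bracket, e1, e2]
  refine ⟨⟨(con₀ R₀ R₁).lift _ H₀, (con₁ R₀ R₁).lift _ H₁, ?_, ?_⟩, ⟨?_, ?_⟩, ?_⟩
  · rintro ⟨x⟩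
    exact bd_eval₁ g₀ g₁ x
  · rintro ⟨a⟩ ⟨b⟩
    exact eval₁_bracket g₀ g₁ a b
  · intro e
    change eval₀ g₀ g₁ (Word₀.gen e) = _
    simp [eval₀, Word₀.gen]
  · intro e
    change eval₁ g₀ g₁ (Word₁.gen e) = _
    simp [eval₁, Word₁.gen]
  · rintro F ⟨hF₀, hF₁⟩
    have k₀ : F.f₀.comp (mk₀ R₀ R₁) = eval₀ g₀ g₁ := by
      ext e
      rcases e with e | e
      · simpa [eval₀, Word₀.gen] using hF₀ e
      · have := F.comm_bd (mk₁ R₀ R₁ (Word₁.gen e))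
        rw [hF₁, bd_mk₁, Word₁.bd_gen] at this
        simpa [eval₀] using this.symm
    have k₁ : F.f₁.comp (mk₁ R₀ R₁) = eval₁ g₀ g₁ := by
      ext e
      rcases e with e | ⟨a, b⟩
      · simpa [eval₁, Word₁.gen] using hF₁ e
      · have := F.comm_bracket (mk₀ R₀ R₁ a) (mk₀ R₀ R₁ b)
        rw [bracket_mk₀] at this
        have ka := DFunLike.congr_fun k₀ a
        have kb := DFunLike.congr_fun k₀ b
        simp only [AddMonoidHom.comp_apply] at ka kb
        rw [ka, kb, ← eval₁_bracket] at this
        exact this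
    apply Hom.ext
    · ext x
      obtain ⟨x⟩ := x
      exact DFunLike.congr_fun k₀ x
    · ext x
      obtain ⟨x⟩ := x
      exact DFunLike.congr_fun k₁ x
end
end

end StableQuadraticModule

/-! ## The stable quadratic module of a Waldhausen category -/

namespace WaldhausenCategory

open StableQuadraticModule

section
variable (C : Type u) [Category.{v} C] [WaldhausenCategory C]

/-- The generators in degree `1`: weak equivalences and cofiber sequences. -/
inductive Gen₁ : Type (max u v)
  | weq {A A' : C} (f : A ⟶ A') (hf : weq f) : Gen₁
  | cofSeq {A B Q : C} (i : A ⟶ B) (q : B ⟶ Q) (h : IsCofiberSeq i q) : Gen₁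
end

section
variable {C : Type u} [Category.{v} C] [WaldhausenCategory C]

/-- The word `[A]`. -/
def wObj (A : C) : Word₀ C (Gen₁ C) := Word₀.gen A

/-- The word `[f : A ⥲ A']`. -/
def wWeq {A A' : C} (f : A ⟶ A') (hf : weq f) : Word₁ C (Gen₁ C) := Word₁.gen (Gen₁.weq f hf)

/-- The word `[A ↣ B ↠ Q]`. -/
def wCof {A B Q : C} (i : A ⟶ B) (q : B ⟶ Q) (h : IsCofiberSeq i q) : Word₁ C (Gen₁ C) :=
  Word₁.gen (Gen₁.cofSeq i q h)

/-- The relations in degree `0`. -/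
inductive DRel₀ : Word₀ C (Gen₁ C) → Word₀ C (Gen₁ C) → Prop
  | bd_weq {A A' : C} (f : A ⟶ A') (hf : weq f) :
      DRel₀ (Word₁.bd (wWeq f hf)) (-wObj A' + wObj A)
  | bd_cofSeq {A B Q : C} (i : A ⟶ B) (q : B ⟶ Q) (h : IsCofiberSeq i q) :
      DRel₀ (Word₁.bd (wCof i q h)) (-wObj B + wObj Q + wObj A)
  | zero : DRel₀ (wObj (zeroObj (C := C))) 0

/-- The relations in degree `1`. -/
inductive DRel₁ : Word₁ C (Gen₁ C) → Word₁ C (Gen₁ C) → Prop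
  | weq_id (A : C) : DRel₁ (wWeq (𝟙 A) (weq_id A)) 0
  | cofSeq_id_toZero (A : C) : DRel₁ (wCof (𝟙 A) (toZero A) (isCofiberSeq_id_toZero A)) 0
  | cofSeq_fromZero_id (A : C) : DRel₁ (wCof (fromZero A) (𝟙 A) (isCofiberSeq_fromZero_id A)) 0
  /-- composable weak equivalences -/
  | weq_comp {A B X : C} (f : A ⟶ B) (g : B ⟶ X) (hf : weq f) (hg : weq g) :
      DRel₁ (wWeq (f ≫ g) (weq_comp f g hf hg)) (wWeq g hg + wWeq f hf)
  /-- weak equivalences of cofiber sequences -/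
  | cofSeq_weq {A B Q A' B' Q' : C} (i : A ⟶ B) (q : B ⟶ Q) (i' : A' ⟶ B') (q' : B' ⟶ Q')
      (h : IsCofiberSeq i q) (h' : IsCofiberSeq i' q')
      (a : A ⟶ A') (b : B ⟶ B') (c : Q ⟶ Q') (ha : weq a) (hb : weq b) (hc : weq c)
      (comm₁ : i ≫ b = a ≫ i') (comm₂ : q ≫ c = b ≫ q') :
      DRel₁ (wWeq a ha + Word₁.act (wWeq c hc) (wObj A))
        (-wCof i' q' h' + wWeq b hb + wCof i q h)
  /-- composable cofibrations `A ↣ B ↣ X`, with `P = B/A`, `R = X/A` and `S = X/B = R/P` -/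
  | cofSeq_comp {A B X P R S : C} (i : A ⟶ B) (j : B ⟶ X) (p : B ⟶ P) (r : X ⟶ R)
      (k : P ⟶ R) (s : R ⟶ S) (comm : j ≫ r = p ≫ k)
      (hAB : IsCofiberSeq i p) (hAX : IsCofiberSeq (i ≫ j) r)
      (hBX : IsCofiberSeq j (r ≫ s)) (hPR : IsCofiberSeq k s) :
      DRel₁ (wCof j (r ≫ s) hBX + wCof i p hAB)
        (wCof (i ≫ j) r hAX + Word₁.act (wCof k s hPR) (wObj A))
  /-- coproducts -/
  | coproduct {A B S : C} (i₁ : A ⟶ S) (i₂ : B ⟶ S) (p₁ : S ⟶ A) (p₂ : S ⟶ B)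
      (h : IsCoproductDiagram i₁ i₂ p₁ p₂) :
      DRel₁ (Word₁.bracket (wObj A) (wObj B))
        (-wCof i₂ p₁ h.symm.isCofiberSeq + wCof i₁ p₂ h.isCofiberSeq)
end

section
variable (C : Type u) [Category.{v} C] [WaldhausenCategory C]

/-- The stable quadratic module `𝒟_* C` of a Waldhausen category. -/
def D : StableQuadraticModule.{max u v, max u v} :=
  presented (DRel₀ (C := C)) (DRel₁ (C := C))

/-- `K₁ C` is the kernel of `∂ : 𝒟₁ C → 𝒟₀ C`. -/
def K₁ : AddSubgroup (D C).C₁ := (D C).bd.ker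
end

section
variable {C : Type u} [Category.{v} C] [WaldhausenCategory C]

/-- The generator `[A]` of `𝒟₀ C`. -/
def objClass (A : C) : (D C).C₀ := mk₀ DRel₀ DRel₁ (wObj A)

/-- The generator `[A ⥲ A']` of `𝒟₁ C`. -/
def weqClass {A A' : C} (f : A ⟶ A') (hf : weq f) : (D C).C₁ := mk₁ DRel₀ DRel₁ (wWeq f hf)

/-- The generator `[A ↣ B ↠ Q]` of `𝒟₁ C`. -/
def cofSeqClass {A B Q : C} (i : A ⟶ B) (q : B ⟶ Q) (h : IsCofiberSeq i q) : (D C).C₁ :=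
  mk₁ DRel₀ DRel₁ (wCof i q h)

theorem bd_weqClass {A A' : C} (f : A ⟶ A') (hf : weq f) :
    (D C).bd (weqClass f hf) = -objClass A' + objClass A :=
  mk₀_eq (DRel₀.bd_weq f hf)

theorem bd_cofSeqClass {A B Q : C} (i : A ⟶ B) (q : B ⟶ Q) (h : IsCofiberSeq i q) :
    (D C).bd (cofSeqClass i q h) = -objClass B + objClass Q + objClass A :=
  mk₀_eq (DRel₀.bd_cofSeq i q h)

/-- A weak cofiber sequence `A ↣ B ↠ X₁ ⥳ X` with prescribed first, second and fourth objects: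
a cofiber sequence followed by a weak equivalence in the opposite direction. -/
structure WeakCofiberSequence (A B X : C) where
  /-- the third object -/
  X₁ : C
  j : A ⟶ B
  r : B ⟶ X₁
  w : X ⟶ X₁
  isCofiberSeq : IsCofiberSeq j r
  weq_w : weq w

/-- `[A ↣ B ↠ X₁ ⥳ X] = [A ↣ B ↠ X₁] + [X ⥲ X₁] ^ [A]`. -/
def WeakCofiberSequence.toD₁ {A B X : C} (l : WeakCofiberSequence A B X) : (D C).C₁ :=
  cofSeqClass l.j l.r l.isCofiberSeq + act (weqClass l.w l.weq_w) (objClass A)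

theorem WeakCofiberSequence.bd_toD₁ {A B X : C} (l : WeakCofiberSequence A B X) :
    (D C).bd l.toD₁ = -objClass B + objClass X + objClass A := by
  simp [toD₁, bd_act, bd_weqClass, bd_cofSeqClass, add_assoc]

variable (C) in
/-- A pair of weak cofiber sequences: two weak cofiber sequences with the first, second and
fourth objects in common. -/
structure PairOfWeakCofiberSequences where
  A : C
  B : C
  X : C
  l₁ : WeakCofiberSequence A B X
  l₂ : WeakCofiberSequence A B X

/-- The element of `K₁ C` represented by a pair of weak cofiber sequences. -/
def PairOfWeakCofiberSequences.toK₁ (P : PairOfWeakCofiberSequences C) : K₁ C :=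
  ⟨-P.l₁.toD₁ + P.l₂.toD₁, by
    simp only [K₁, AddMonoidHom.mem_ker, map_add, map_neg, WeakCofiberSequence.bd_toD₁]
    exact neg_add_cancel _⟩

theorem PairOfWeakCofiberSequences.toK₁_eq_sub (P : PairOfWeakCofiberSequences C) :
    (P.toK₁ : (D C).C₁) = P.l₂.toD₁ - P.l₁.toD₁ := by
  have h := add_comm_of_bd_eq_zero P.toK₁.2 P.l₁.toD₁
  rw [eq_sub_iff_add_eq, h]
  simp [toK₁]
end

end WaldhausenCategory

/-! Brackets are central in `𝒟₁ C`, and modulo the subgroup they generate the group becomes abelian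
(`Reduced`) and the action of `𝒟₀ C` disappears. There every element is a signed sum of generators.
A weak equivalence `A ⥲ A'` is the difference of two weak cofiber sequences, `* ↣ A' ↠ A' ⥳ A` and
the trivial one on `A`; a cofiber sequence `A ↣ B ↠ Q` is compared with the split one on `A ⨿ Q`.
Coproducts of weak cofiber sequences add classes, up to the classes `sumRed` of split sequences. So
any `x` is congruent to `-l₁ + l₂` plus such corrections, where `l₁` and `l₂` share their first and
fourth objects and have as middle objects the coproducts of two formal sums `S` and `T`
(`exists_red_eq`).

If `∂ x = 0`, mapping boundaries to the free abelian group on the objects other than `*` shows that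
`S` and `T` have the same nonzero entries. Their coproducts are then identified by an isomorphism
made of symmetries, associators and unit isomorphisms, whose class is precisely the total correction
(`sumEquiv_of_red_eq`). Transporting `l₁` along it gives a pair `P` with `x = P + y`, where `y` is a
sum of brackets and `∂ y = 0` (`exists_pair_add`).

It remains to absorb `y`. A well-ordering of the objects defines a homomorphism from `𝒟₀ C` to a
central extension which recovers `⟨[A], [B]⟩` from its boundary for `A ≠ B`, and loses only the
2-torsion elements `⟨[A], [A]⟩`. These are closed under sums, so `y` is a single one of them
(`eq_bracket_self_of_bd_eq_zero`). Such an element is the class of the symmetry of `A ⨿ A`: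
adjoining `A ⨿ A` to the middle and quotient objects of `P`, and twisting one of the two sequences
by the symmetry, adds it to the class of the pair (`exists_toK₁_eq_add`). -/

namespace WaldhausenCategory

/-! ### Coproducts in a Waldhausen category and their cofiber sequences. -/

section Coproducts
variable {C : Type u} [Category.{v} C] [WaldhausenCategory C]

noncomputable instance instHasZeroMorphisms : HasZeroMorphisms C where
  zero A B := ⟨toZero A ≫ fromZero B⟩
  comp_zero f Z := by
    change f ≫ toZero _ ≫ fromZero _ = toZero _ ≫ fromZero _
    rw [← Category.assoc]
    congr 1
    exact isZero_zeroObj.eq_of_tgt _ _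
  zero_comp X _ _ f := by
    change (toZero _ ≫ fromZero _) ≫ f = toZero _ ≫ fromZero _
    rw [Category.assoc]
    congr 1
    exact isZero_zeroObj.eq_of_src _ _

theorem toZero_eq_zero (A : C) : toZero A = 0 := isZero_zeroObj.eq_of_tgt _ _

theorem toZero_comp_fromZero (A B : C) : toZero A ≫ fromZero B = 0 := rfl

/-- A coproduct is a pushout under `*`, and `* ⟶ A` is a cofibration. -/
instance instHasBinaryCoproducts : HasBinaryCoproducts C := by
  have : ∀ A B : C, HasColimit (pair A B) := fun A B => by
    have := hasPushout (fromZero A) (fromZero B) (cof_zero A)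
    have h := IsPushout.of_hasPushout (fromZero A) (fromZero B)
    exact ⟨⟨_, isCoproductOfIsInitialIsPushout _ _ _ _ isZero_zeroObj.isInitial h.isColimit⟩⟩
  exact hasBinaryCoproducts_of_hasColimit_pair C

attribute [local simp] coprod.inl_desc coprod.inr_desc coprod.inl_desc_assoc coprod.inr_desc_assoc

/-- A cofibration together with a cokernel of it is a cofiber sequence. -/
theorem isCofiberSeq_of_desc {A B Q : C} {i : A ⟶ B} {q : B ⟶ Q} (hi : cof i) (w : i ≫ q = 0)
    (desc : ∀ {T : C} (f : B ⟶ T), i ≫ f = 0 → ∃ g : Q ⟶ T, q ≫ g = f)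
    (hom_ext : ∀ {T : C} (f g : Q ⟶ T), q ≫ f = q ≫ g → f = g) : IsCofiberSeq i q := by
  have aux (s : PushoutCocone i (toZero A)) : i ≫ s.inl = 0 := by
    rw [s.condition]
    exact (congrArg (· ≫ s.inr) (toZero_eq_zero A)).trans zero_comp
  refine ⟨hi, ⟨by rw [w, toZero_comp_fromZero]⟩, ⟨PushoutCocone.IsColimit.mk _
    (fun s => (desc s.inl (aux s)).choose) (fun s => (desc s.inl (aux s)).choose_spec)
    (fun s => isZero_zeroObj.eq_of_src _ _) (fun s m h₁ _ => hom_ext _ _ ?_)⟩⟩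
  rw [h₁, (desc s.inl (aux s)).choose_spec]

namespace IsCofiberSeq
variable {A B Q : C} {i : A ⟶ B} {q : B ⟶ Q}

theorem zero (h : IsCofiberSeq i q) : i ≫ q = 0 := by
  rw [h.2.w, toZero_comp_fromZero]

theorem exists_desc (h : IsCofiberSeq i q) {T : C} (f : B ⟶ T) (w : i ≫ f = 0) :
    ∃ g : Q ⟶ T, q ≫ g = f :=
  ⟨h.2.desc f (fromZero T) (by rw [w, toZero_comp_fromZero]), h.2.inl_desc _ _ _⟩

theorem hom_ext (h : IsCofiberSeq i q) {T : C} {f g : Q ⟶ T} (w : q ≫ f = q ≫ g) : f = g :=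
  h.2.hom_ext w (isZero_zeroObj.eq_of_src _ _)

theorem comp_iso (h : IsCofiberSeq i q) {B' : C} (θ : B ≅ B') :
    IsCofiberSeq (i ≫ θ.hom) (θ.inv ≫ q) :=
  isCofiberSeq_of_desc (cof_comp _ _ h.1 (cof_of_isIso _ inferInstance)) (by simp [h.zero])
    (fun f w => by
      obtain ⟨g, hg⟩ := h.exists_desc (θ.hom ≫ f) (by simpa using w)
      exact ⟨g, by simp [hg]⟩)
    (fun f g w => h.hom_ext (by simpa using w))

end IsCofiberSeq

noncomputable section

/-- The projection `A ⨿ B ⟶ A`. -/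
def coprodFst (A B : C) : A ⨿ B ⟶ A := coprod.desc (𝟙 A) 0

/-- The projection `A ⨿ B ⟶ B`. -/
def coprodSnd (A B : C) : A ⨿ B ⟶ B := coprod.desc 0 (𝟙 B)

@[simp]
theorem inl_coprodFst (A B : C) : coprod.inl ≫ coprodFst A B = 𝟙 A := by simp [coprodFst]

@[simp]
theorem inl_coprodFst_assoc (A B : C) {T : C} (f : A ⟶ T) :
    coprod.inl ≫ coprodFst A B ≫ f = f := by simp [coprodFst]

@[simp]
theorem inr_coprodFst (A B : C) : coprod.inr ≫ coprodFst A B = 0 := by simp [coprodFst]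

@[simp]
theorem inr_coprodFst_assoc (A B : C) {T : C} (f : A ⟶ T) :
    coprod.inr ≫ coprodFst A B ≫ f = 0 := by simp [coprodFst]

@[simp]
theorem inl_coprodSnd (A B : C) : coprod.inl ≫ coprodSnd A B = 0 := by simp [coprodSnd]

@[simp]
theorem inl_coprodSnd_assoc (A B : C) {T : C} (f : B ⟶ T) :
    coprod.inl ≫ coprodSnd A B ≫ f = 0 := by simp [coprodSnd]

@[simp]
theorem inr_coprodSnd (A B : C) : coprod.inr ≫ coprodSnd A B = 𝟙 B := by simp [coprodSnd]

@[simp]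
theorem inr_coprodSnd_assoc (A B : C) {T : C} (f : B ⟶ T) :
    coprod.inr ≫ coprodSnd A B ≫ f = f := by simp [coprodSnd]

end

theorem isCoproductDiagram_coprod (A B : C) :
    IsCoproductDiagram (coprod.inl : A ⟶ A ⨿ B) coprod.inr (coprodFst A B) (coprodSnd A B) where
  isColimit := ⟨coprodIsCoprod A B⟩
  inl_fst := by simp
  inr_fst := by simp [toZero_comp_fromZero]
  inl_snd := by simp [toZero_comp_fromZero]
  inr_snd := by simp

theorem isCofiberSeq_inl (A B : C) :
    IsCofiberSeq (coprod.inl : A ⟶ A ⨿ B) (coprodSnd A B) :=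
  (isCoproductDiagram_coprod A B).isCofiberSeq

theorem isCofiberSeq_inr (A B : C) :
    IsCofiberSeq (coprod.inr : B ⟶ A ⨿ B) (coprodFst A B) :=
  (isCoproductDiagram_coprod A B).symm.isCofiberSeq

theorem isPushout_coprod (A B : C) :
    IsPushout (fromZero A) (fromZero B) (coprod.inl : A ⟶ A ⨿ B) coprod.inr := by
  have k : IsPushout (isZero_zeroObj.isInitial.to B) (isZero_zeroObj.isInitial.to A)
      coprod.inr coprod.inl := IsPushout.of_isColimit_binaryCofan_of_isInitial
    (coprodIsCoprod A B) isZero_zeroObj.isInitial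
  rw [isZero_zeroObj.eq_of_src (fromZero A) (isZero_zeroObj.isInitial.to A),
    isZero_zeroObj.eq_of_src (fromZero B) (isZero_zeroObj.isInitial.to B)]
  exact k.flip

theorem cof_coprod_map_id {A B : C} {i : A ⟶ B} (hi : cof i) (X : C) :
    cof (coprod.map i (𝟙 X)) :=
  cof_cobaseChange (IsPushout.of_coprod_inl_with_id i X).flip hi

/-- One factor is changed at a time; each step is a cobase change of `i` or `i'`, up to the
symmetry. -/
theorem cof_coprod_map {A B A' B' : C} {i : A ⟶ B} {i' : A' ⟶ B'} (hi : cof i) (hi' : cof i') :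
    cof (coprod.map i i') := by
  have h : coprod.map i i' = coprod.map i (𝟙 A') ≫ (coprod.braiding B A').hom ≫
      coprod.map i' (𝟙 B) ≫ (coprod.braiding B' B).hom := by
    ext <;> simp
  rw [h]
  exact cof_comp _ _ (cof_coprod_map_id hi _) (cof_comp _ _ (cof_of_isIso _ inferInstance)
    (cof_comp _ _ (cof_coprod_map_id hi' _) (cof_of_isIso _ inferInstance)))

/-- This is the gluing axiom for coproducts viewed as pushouts under `*`. -/
theorem weq_coprod_map {A B A' B' : C} {f : A ⟶ B} {f' : A' ⟶ B'} (hf : weq f) (hf' : weq f') :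
    weq (coprod.map f f') :=
  gluing (𝟙 _) f f' (coprod.map f f') (isPushout_coprod A A') (isPushout_coprod B B')
    (cof_zero A) (cof_zero B) (weq_id _) hf hf' (isZero_zeroObj.eq_of_src _ _)
    (isZero_zeroObj.eq_of_src _ _) (by simp) (by simp)

theorem weq_iso {A B : C} (θ : A ≅ B) : weq θ.hom := weq_of_isIso _ inferInstance

namespace IsCofiberSeq
variable {A B Q A' B' Q' : C} {i : A ⟶ B} {q : B ⟶ Q} {i' : A' ⟶ B'} {q' : B' ⟶ Q'}

theorem coprod_map (h : IsCofiberSeq i q) (h' : IsCofiberSeq i' q') :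
    IsCofiberSeq (coprod.map i i') (coprod.map q q') := by
  refine isCofiberSeq_of_desc (cof_coprod_map h.1 h'.1) ?_ ?_ ?_
  · ext <;> simp [h.zero, h'.zero]
  · intro T f w
    obtain ⟨g, hg⟩ := h.exists_desc (coprod.inl ≫ f) (by simpa using coprod.inl ≫= w)
    obtain ⟨g', hg'⟩ := h'.exists_desc (coprod.inr ≫ f) (by simpa using coprod.inr ≫= w)
    exact ⟨coprod.desc g g', by ext <;> simp [hg, hg']⟩
  · intro T f g w
    ext
    · exact h.hom_ext (by simpa using coprod.inl ≫= w)
    · exact h'.hom_ext (by simpa using coprod.inr ≫= w)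

/-- `A ⟶ B ⨿ X ⟶ Q ⨿ X` is a cofiber sequence. -/
theorem comp_inl (h : IsCofiberSeq i q) (X : C) :
    IsCofiberSeq (i ≫ (coprod.inl : B ⟶ B ⨿ X)) (coprod.map q (𝟙 X)) := by
  refine isCofiberSeq_of_desc (cof_comp _ _ h.1 (isCofiberSeq_inl B X).1) ?_ ?_ ?_
  · simp [reassoc_of% h.zero]
  · intro T f w
    obtain ⟨g, hg⟩ := h.exists_desc (coprod.inl ≫ f) (by simpa using w)
    exact ⟨coprod.desc g (coprod.inr ≫ f), by ext <;> simp [hg]⟩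
  · intro T f g w
    ext
    · exact h.hom_ext (by simpa using coprod.inl ≫= w)
    · simpa using coprod.inr ≫= w

/-- `A ⨿ X ⟶ B ⨿ X ⟶ Q` is a cofiber sequence. -/
theorem coprod_map_id (h : IsCofiberSeq i q) (X : C) :
    IsCofiberSeq (coprod.map i (𝟙 X)) (coprodFst B X ≫ q) := by
  refine isCofiberSeq_of_desc (cof_coprod_map_id h.1 X) ?_ ?_ ?_
  · ext <;> simp [h.zero]
  · intro T f w
    obtain ⟨g, hg⟩ := h.exists_desc (coprod.inl ≫ f) (by simpa using coprod.inl ≫= w)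
    exact ⟨g, by ext <;> simp [hg]; simpa using (coprod.inr ≫= w).symm⟩
  · intro T f g w
    exact h.hom_ext (by simpa using coprod.inl ≫= w)

/-- `X ⨿ A ⟶ X ⨿ B ⟶ Q` is a cofiber sequence. -/
theorem coprod_id_map (h : IsCofiberSeq i q) (X : C) :
    IsCofiberSeq (coprod.map (𝟙 X) i) (coprodSnd X B ≫ q) := by
  refine isCofiberSeq_of_desc (cof_coprod_map (cof_of_isIso _ inferInstance) h.1) ?_ ?_ ?_
  · ext <;> simp [h.zero]
  · intro T f w
    obtain ⟨g, hg⟩ := h.exists_desc (coprod.inr ≫ f) (by simpa using coprod.inr ≫= w)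
    exact ⟨g, by ext <;> simp [hg]; simpa using (coprod.inl ≫= w).symm⟩
  · intro T f g w
    exact h.hom_ext (by simpa using coprod.inr ≫= w)

end IsCofiberSeq

end Coproducts

end WaldhausenCategory

/-! ### The abelian quotient of degree one by the brackets. -/

namespace StableQuadraticModule

section Reduced
variable (M : StableQuadraticModule.{u₀, u₁})

/-- The values of the bracket are central. -/
theorem bracket_add_comm (a b : M.C₀) (x : M.C₁) : M.bracket a b + x = x + M.bracket a b := by
  -- The commutator of `x` and `⟨a, b⟩` is a bracket with entry `∂⟨a, b⟩`; that entry is a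
  -- commutator, and brackets vanish on commutators.
  have h := M.bracket_bd (M.bracket a b) x
  rw [M.bd_bracket, bracket_addComm_left] at h
  have h2 : -(M.bracket a b + x) + (x + M.bracket a b) = 0 := by
    rw [neg_add_rev, ← add_assoc]
    exact h.symm
  exact neg_add_eq_zero.mp h2

/-- The subgroup of `C₁` generated by the values of the bracket. -/
def bracketSubgroup : AddSubgroup M.C₁ :=
  AddSubgroup.closure {y | ∃ a b, y = M.bracket a b}

theorem bracketSubgroup_le_center : M.bracketSubgroup ≤ AddSubgroup.center M.C₁ := by
  refine (AddSubgroup.closure_le _).2 ?_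
  rintro _ ⟨a, b, rfl⟩
  exact AddSubgroup.mem_center_iff.2 fun x => (M.bracket_add_comm a b x).symm

instance : M.bracketSubgroup.Normal where
  conj_mem y hy x := by
    have h := AddSubgroup.mem_center_iff.1 (M.bracketSubgroup_le_center hy) x
    rwa [h, add_neg_cancel_right]

/-- The quotient of `C₁` by the values of the bracket. -/
def Reduced : Type u₁ := M.C₁ ⧸ M.bracketSubgroup

/-- The projection of `C₁` onto its quotient by the values of the bracket. -/
def mkReduced (x : M.C₁) : M.Reduced := QuotientAddGroup.mk x

theorem mkReduced_eq_iff (x y : M.C₁) :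
    M.mkReduced x = M.mkReduced y ↔ -x + y ∈ M.bracketSubgroup :=
  QuotientAddGroup.eq

/-- Commutativity holds because every commutator in `C₁` is the bracket of two boundaries. -/
instance : AddCommGroup M.Reduced :=
  { (inferInstance : AddGroup (M.C₁ ⧸ M.bracketSubgroup)) with
    add_comm := by
      rintro ⟨x⟩ ⟨y⟩
      refine (M.mkReduced_eq_iff (x + y) (y + x)).2 (AddSubgroup.subset_closure
        ⟨M.bd x, M.bd y, ?_⟩)
      rw [M.bracket_bd, addComm, neg_add_rev, ← add_assoc] }

/-- The projection of `C₁` onto its quotient by the values of the bracket, as a homomorphism. -/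
def toReduced : M.C₁ →+ M.Reduced where
  toFun := M.mkReduced
  map_zero' := rfl
  map_add' _ _ := rfl

theorem toReduced_eq_iff (x y : M.C₁) :
    M.toReduced x = M.toReduced y ↔ -x + y ∈ M.bracketSubgroup :=
  QuotientAddGroup.eq

variable {M}

@[simp]
theorem toReduced_bracket (a b : M.C₀) : M.toReduced (M.bracket a b) = 0 := by
  rw [← map_zero M.toReduced, eq_comm, toReduced_eq_iff, neg_zero, zero_add]
  exact AddSubgroup.subset_closure ⟨a, b, rfl⟩

@[simp]
theorem toReduced_act (x : M.C₁) (a : M.C₀) : M.toReduced (act x a) = M.toReduced x := by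
  simp [act]

@[simp]
theorem act_zero_right (x : M.C₁) : act x 0 = x := by simp [act, bracket_zero_left]

@[simp]
theorem act_zero_left (a : M.C₀) : act (0 : M.C₁) a = 0 := by
  have h := M.bracket_add_right a 0 0
  simpa [act] using h

theorem act_add (x y : M.C₁) (a : M.C₀) : act (x + y) a = act x a + act y a := by
  simp only [act, map_add, M.bracket_add_right]
  rw [add_assoc, add_assoc, ← add_assoc y, ← M.bracket_add_comm a (M.bd x) (y), add_assoc]

theorem act_neg (x : M.C₁) (a : M.C₀) : act (-x) a = -act x a := by
  rw [eq_neg_iff_add_eq_zero, ← act_add, neg_add_cancel, act_zero_left]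

end Reduced

end StableQuadraticModule

/-! ### Relations and induction principles for `𝒟_* C`. -/

namespace WaldhausenCategory

open StableQuadraticModule

section Relations
variable {C : Type u} [Category.{v} C] [WaldhausenCategory C]

@[simp]
theorem objClass_zeroObj : objClass (zeroObj (C := C)) = 0 := mk₀_eq DRel₀.zero

@[simp]
theorem weqClass_id (A : C) (h : weq (𝟙 A)) : weqClass (𝟙 A) h = 0 := mk₁_eq (DRel₁.weq_id A)

@[simp]
theorem cofSeqClass_fromZero (A : C) (h : IsCofiberSeq (fromZero A) (𝟙 A)) :
    cofSeqClass (fromZero A) (𝟙 A) h = 0 := mk₁_eq (DRel₁.cofSeq_fromZero_id A)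

theorem weqClass_comp {A B X : C} (f : A ⟶ B) (g : B ⟶ X) (hf : weq f) (hg : weq g)
    (hfg : weq (f ≫ g)) : weqClass (f ≫ g) hfg = weqClass g hg + weqClass f hf :=
  mk₁_eq (DRel₁.weq_comp f g hf hg)

theorem cofSeqClass_weq {A B Q A' B' Q' : C} {i : A ⟶ B} {q : B ⟶ Q} {i' : A' ⟶ B'}
    {q' : B' ⟶ Q'} (h : IsCofiberSeq i q) (h' : IsCofiberSeq i' q')
    {a : A ⟶ A'} {b : B ⟶ B'} {c : Q ⟶ Q'} (ha : weq a) (hb : weq b) (hc : weq c)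
    (comm₁ : i ≫ b = a ≫ i') (comm₂ : q ≫ c = b ≫ q') :
    weqClass a ha + act (weqClass c hc) (objClass A) =
      -cofSeqClass i' q' h' + weqClass b hb + cofSeqClass i q h :=
  mk₁_eq (DRel₁.cofSeq_weq i q i' q' h h' a b c ha hb hc comm₁ comm₂)

theorem cofSeqClass_comp {A B X P R S : C} {i : A ⟶ B} {j : B ⟶ X} {p : B ⟶ P} {r : X ⟶ R}
    {k : P ⟶ R} {s : R ⟶ S} {l : A ⟶ X} {t : X ⟶ S} (comm : j ≫ r = p ≫ k)
    (hl : i ≫ j = l) (ht : r ≫ s = t)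
    (hAB : IsCofiberSeq i p) (hAX : IsCofiberSeq l r)
    (hBX : IsCofiberSeq j t) (hPR : IsCofiberSeq k s) :
    cofSeqClass j t hBX + cofSeqClass i p hAB =
      cofSeqClass l r hAX + act (cofSeqClass k s hPR) (objClass A) := by
  subst hl ht
  exact mk₁_eq (DRel₁.cofSeq_comp i j p r k s comm hAB hAX hBX hPR)

theorem bracket_objClass {A B S : C} {i₁ : A ⟶ S} {i₂ : B ⟶ S} {p₁ : S ⟶ A} {p₂ : S ⟶ B}
    (h : IsCoproductDiagram i₁ i₂ p₁ p₂) :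
    (D C).bracket (objClass A) (objClass B) =
      -cofSeqClass i₂ p₁ h.symm.isCofiberSeq + cofSeqClass i₁ p₂ h.isCofiberSeq :=
  mk₁_eq (DRel₁.coproduct i₁ i₂ p₁ p₂ h)

/-- Every element of `𝒟₁ C` is a sum of generators, their inverses and values of the bracket. -/
theorem D.induction_on {p : (D C).C₁ → Prop} (x : (D C).C₁) (zero : p 0)
    (weq : ∀ {A A' : C} (f : A ⟶ A') (hf : weq f), p (weqClass f hf))
    (cofSeq : ∀ {A B Q : C} (i : A ⟶ B) (q : B ⟶ Q) (h : IsCofiberSeq i q),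
      p (cofSeqClass i q h))
    (bracket : ∀ a b, p ((D C).bracket a b))
    (neg : ∀ x, p x → p (-x)) (add : ∀ x y, p x → p y → p (x + y)) : p x := by
  obtain ⟨x⟩ := x
  change p (mk₁ DRel₀ DRel₁ x)
  have gen (e : Gen₁ C ⊕ (Word₀ C (Gen₁ C) × Word₀ C (Gen₁ C))) :
      p (mk₁ DRel₀ DRel₁ (FreeAddGroup.of e)) := by
    rcases e with (⟨f, hf⟩ | ⟨i, q, h⟩) | ⟨a, b⟩
    · exact weq f hf
    · exact cofSeq i q h
    · exact bracket (mk₀ DRel₀ DRel₁ a) (mk₀ DRel₀ DRel₁ b)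
  induction x using FreeAddGroup.induction_on with
  | C1 => exact zero
  | of e => exact gen e
  | neg_of e _ => exact neg _ (gen e)
  | add x y hx hy => exact add _ _ hx hy

/-- The group `𝒟₀ C` is generated by the classes of objects. -/
theorem D.induction_on₀ {p : (D C).C₀ → Prop} (a : (D C).C₀) (zero : p 0)
    (obj : ∀ A : C, p (objClass A)) (neg : ∀ a, p a → p (-a))
    (add : ∀ a b, p a → p b → p (a + b)) : p a := by
  obtain ⟨a⟩ := a
  change p (mk₀ DRel₀ DRel₁ a)
  have gen (e : C ⊕ Gen₁ C) : p (mk₀ DRel₀ DRel₁ (FreeAddGroup.of e)) := by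
    rcases e with A | (⟨f, hf⟩ | ⟨i, q, h⟩)
    · exact obj A
    · have h : p ((D C).bd (weqClass f hf)) := by
        rw [bd_weqClass]
        exact add _ _ (neg _ (obj _)) (obj _)
      rwa [← Word₁.bd_gen]
    · have h : p ((D C).bd (cofSeqClass i q h)) := by
        rw [bd_cofSeqClass]
        exact add _ _ (add _ _ (neg _ (obj _)) (obj _)) (obj _)
      rwa [← Word₁.bd_gen]
  induction a using FreeAddGroup.induction_on with
  | C1 => exact zero
  | of e => exact gen e
  | neg_of e _ => exact neg _ (gen e)
  | add x y hx hy => exact add _ _ hx hy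

end Relations

end WaldhausenCategory

/-! ### Classes modulo brackets, and their behaviour under coproducts. -/

namespace WaldhausenCategory

open StableQuadraticModule

section ReducedClasses
variable {C : Type u} [Category.{v} C] [WaldhausenCategory C]

attribute [local simp] coprod.inl_desc coprod.inr_desc coprod.inl_desc_assoc coprod.inr_desc_assoc

/-- The class of a weak equivalence modulo brackets. -/
def weqRed {A A' : C} (f : A ⟶ A') (hf : weq f) : (D C).Reduced := (D C).toReduced (weqClass f hf)

/-- The class of a cofiber sequence modulo brackets. -/
def cofRed {A B Q : C} (i : A ⟶ B) (q : B ⟶ Q) (h : IsCofiberSeq i q) : (D C).Reduced :=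
  (D C).toReduced (cofSeqClass i q h)

/-- The class of a weak cofiber sequence modulo brackets. -/
def WeakCofiberSequence.red {A B X : C} (l : WeakCofiberSequence A B X) : (D C).Reduced :=
  (D C).toReduced l.toD₁

theorem WeakCofiberSequence.red_eq {A B X : C} (l : WeakCofiberSequence A B X) :
    l.red = cofRed l.j l.r l.isCofiberSeq + weqRed l.w l.weq_w := by
  simp [red, toD₁, cofRed, weqRed]

@[simp]
theorem weqRed_id (A : C) (h : weq (𝟙 A)) : weqRed (𝟙 A) h = 0 := by simp [weqRed]

@[simp]
theorem cofRed_fromZero (A : C) (h : IsCofiberSeq (fromZero A) (𝟙 A)) :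
    cofRed (fromZero A) (𝟙 A) h = 0 := by simp [cofRed]

theorem weqRed_comp {A B X : C} (f : A ⟶ B) (g : B ⟶ X) (hf : weq f) (hg : weq g)
    (hfg : weq (f ≫ g)) : weqRed (f ≫ g) hfg = weqRed g hg + weqRed f hf := by
  simp only [weqRed, weqClass_comp f g hf hg, map_add]

theorem cofRed_weq {A B Q A' B' Q' : C} {i : A ⟶ B} {q : B ⟶ Q} {i' : A' ⟶ B'}
    {q' : B' ⟶ Q'} (h : IsCofiberSeq i q) (h' : IsCofiberSeq i' q')
    {a : A ⟶ A'} {b : B ⟶ B'} {c : Q ⟶ Q'} (ha : weq a) (hb : weq b) (hc : weq c)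
    (comm₁ : i ≫ b = a ≫ i') (comm₂ : q ≫ c = b ≫ q') :
    weqRed a ha + weqRed c hc = -cofRed i' q' h' + weqRed b hb + cofRed i q h := by
  simpa [weqRed, cofRed] using
    congrArg (D C).toReduced (cofSeqClass_weq h h' ha hb hc comm₁ comm₂)

theorem cofRed_comp {A B X P R S : C} {i : A ⟶ B} {j : B ⟶ X} {p : B ⟶ P} {r : X ⟶ R}
    {k : P ⟶ R} {s : R ⟶ S} {l : A ⟶ X} {t : X ⟶ S} (comm : j ≫ r = p ≫ k)
    (hl : i ≫ j = l) (ht : r ≫ s = t)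
    (hAB : IsCofiberSeq i p) (hAX : IsCofiberSeq l r)
    (hBX : IsCofiberSeq j t) (hPR : IsCofiberSeq k s) :
    cofRed j t hBX + cofRed i p hAB = cofRed l r hAX + cofRed k s hPR := by
  simpa [cofRed] using
    congrArg (D C).toReduced (cofSeqClass_comp comm hl ht hAB hAX hBX hPR)

/-- The class modulo brackets of the cofiber sequence `A ⟶ A ⨿ B ⟶ B`. -/
noncomputable def sumRed (A B : C) : (D C).Reduced := cofRed _ _ (isCofiberSeq_inl A B)

theorem sumRed_def (A B : C) : sumRed A B = cofRed _ _ (isCofiberSeq_inl A B) := rfl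

/-- By the coproduct relation the two split sequences on `A ⨿ B` differ by a bracket. -/
theorem cofRed_inr (A B : C) : cofRed _ _ (isCofiberSeq_inr A B) = sumRed A B := by
  have h := congrArg (D C).toReduced (bracket_objClass (isCoproductDiagram_coprod A B))
  rw [toReduced_bracket, map_add, map_neg, eq_comm, neg_add_eq_zero] at h
  exact h

theorem weqRed_coprod_map {A B A' B' : C} {f : A ⟶ B} {f' : A' ⟶ B'} (hf : weq f)
    (hf' : weq f') (h : weq (coprod.map f f')) :
    weqRed (coprod.map f f') h = weqRed f hf + weqRed f' hf' + sumRed B B' - sumRed A A' := by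
  rw [cofRed_weq (isCofiberSeq_inl A A') (isCofiberSeq_inl B B') hf h hf' (by simp)
    (by ext <;> simp)]
  simp only [sumRed]
  abel

theorem weqRed_braiding (A B : C) (h : weq (coprod.braiding A B).hom) :
    weqRed (coprod.braiding A B).hom h = sumRed B A - sumRed A B := by
  have k := cofRed_weq (isCofiberSeq_inl A B) (isCofiberSeq_inr B A) (weq_id A) h (weq_id B)
    (by simp) (by ext <;> simp)
  rw [cofRed_inr, weqRed_id, weqRed_id, add_zero, eq_comm, add_right_comm, ← sub_eq_zero] at k
  rw [← sub_eq_zero, ← k, sumRed, sumRed]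
  abel

theorem weqRed_iso_inv {A B : C} (θ : A ≅ B) (h : weq θ.inv) (h' : weq θ.hom) :
    weqRed θ.inv h = - weqRed θ.hom h' := by
  have k := weqRed_comp θ.hom θ.inv h' h (by simpa using weq_id A)
  simp only [θ.hom_inv_id, weqRed_id] at k
  exact eq_neg_of_add_eq_zero_left k.symm

/-- The filtration `A ↣ A ⨿ B ↣ (A ⨿ B) ⨿ X` computes the class of `A ↣ (A ⨿ B) ⨿ X ↠ B ⨿ X`, which
the associator carries to the split sequence on `A ⨿ (B ⨿ X)`. -/
theorem weqRed_associator (A B X : C) (h : weq (coprod.associator A B X).hom) :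
    weqRed (coprod.associator A B X).hom h =
      sumRed A (B ⨿ X) + sumRed B X - sumRed (A ⨿ B) X - sumRed A B := by
  have hl : IsCofiberSeq ((coprod.inl : A ⟶ A ⨿ B) ≫ (coprod.inl : A ⨿ B ⟶ (A ⨿ B) ⨿ X))
      (coprod.map (coprodSnd A B) (𝟙 X)) := (isCofiberSeq_inl A B).comp_inl X
  have h1 := cofRed_comp (by simp) rfl (by ext <;> simp) (isCofiberSeq_inl A B) hl
    (isCofiberSeq_inl (A ⨿ B) X) (isCofiberSeq_inl B X)
  have h2 := cofRed_weq hl (isCofiberSeq_inl A (B ⨿ X)) (weq_id A) h (weq_id _)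
    (by simp) (by ext <;> simp)
  rw [weqRed_id, weqRed_id, add_zero] at h2
  simp only [← sumRed_def] at h1 h2
  rw [eq_sub_of_add_eq h1.symm, eq_comm, add_assoc, neg_add_eq_zero, ← sub_eq_iff_eq_add] at h2
  rw [← h2]
  abel

/-- The isomorphism `* ⨿ A ≅ A`. -/
noncomputable def zeroCoprodIso (A : C) : zeroObj (C := C) ⨿ A ≅ A where
  hom := coprodSnd _ A
  inv := coprod.inr
  hom_inv_id := by
    ext
    · exact isZero_zeroObj.eq_of_src _ _
    · simp

theorem weqRed_zeroCoprodIso (A : C) (h : weq (zeroCoprodIso A).hom) :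
    weqRed (zeroCoprodIso A).hom h = - sumRed zeroObj A := by
  have k := cofRed_weq (isCofiberSeq_inl zeroObj A) (isCofiberSeq_fromZero_id A)
    (weq_id zeroObj) h (weq_id A) (isZero_zeroObj.eq_of_src _ _) (by simp [zeroCoprodIso])
  simp only [weqRed_id, cofRed_fromZero, neg_zero, zero_add] at k
  exact eq_neg_of_add_eq_zero_left k.symm

/-- The cofibration `A ↣ B ⨿ X` factors through `A ⨿ X` and through `B`; the relation for composable
cofibrations is applied to both factorizations. -/
theorem cofRed_coprod_map_id {A B Q : C} {i : A ⟶ B} {q : B ⟶ Q} (h : IsCofiberSeq i q) (X : C)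
    (hX : IsCofiberSeq (coprod.map i (𝟙 X)) (coprodFst B X ≫ q)) :
    cofRed _ _ hX = cofRed i q h + sumRed B X - sumRed A X := by
  have h1 := cofRed_comp (by ext <;> simp [h.zero]) (by simp) (by ext <;> simp)
    (isCofiberSeq_inl A X)
    (h.comp_inl X) hX (isCofiberSeq_inr Q X)
  have h2 := cofRed_comp (by simp) rfl (by ext <;> simp) h
    (h.comp_inl X) (isCofiberSeq_inl B X) (isCofiberSeq_inl Q X)
  rw [cofRed_inr] at h1
  simp only [← sumRed_def] at h1 h2
  rw [← h2, ← eq_sub_iff_add_eq] at h1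
  rw [h1]
  abel

theorem cofRed_coprod_id_map {A B Q : C} {i : A ⟶ B} {q : B ⟶ Q} (h : IsCofiberSeq i q) (X : C) :
    cofRed _ _ (h.coprod_id_map X) = cofRed i q h + sumRed X B - sumRed X A := by
  have h1 := cofRed_weq (h.coprod_map_id X) (h.coprod_id_map X)
    (weq_iso (coprod.braiding A X)) (weq_iso (coprod.braiding B X)) (weq_id Q)
    (by ext <;> simp) (by ext <;> simp)
  rw [weqRed_id, weqRed_braiding, weqRed_braiding, cofRed_coprod_map_id h, ← sub_eq_zero] at h1
  rw [← sub_eq_zero, ← h1]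
  abel

/-- The filtration is `A ⨿ A' ↣ B ⨿ A' ↣ B ⨿ B'`, with successive quotients `Q` and `Q'`. -/
theorem cofRed_coprod_map {A B Q A' B' Q' : C} {i : A ⟶ B} {q : B ⟶ Q} {i' : A' ⟶ B'}
    {q' : B' ⟶ Q'} (h : IsCofiberSeq i q) (h' : IsCofiberSeq i' q') :
    cofRed _ _ (h.coprod_map h') =
      cofRed i q h + cofRed i' q' h' + sumRed B B' - sumRed A A' - sumRed Q Q' := by
  have h1 := cofRed_comp (by ext <;> simp [h'.zero]) (by ext <;> simp) (by ext <;> simp)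
    (h.coprod_map_id A') (h.coprod_map h') (h'.coprod_id_map B) (isCofiberSeq_inl Q Q')
  rw [cofRed_coprod_id_map h', cofRed_coprod_map_id h, ← sub_eq_iff_eq_add] at h1
  rw [← h1, sumRed]
  abel

namespace WeakCofiberSequence

/-- The coproduct of two weak cofiber sequences. -/
noncomputable def coprod {A B X A' B' X' : C} (l : WeakCofiberSequence A B X)
    (l' : WeakCofiberSequence A' B' X') :
    WeakCofiberSequence (A ⨿ A') (B ⨿ B') (X ⨿ X') where
  X₁ := l.X₁ ⨿ l'.X₁
  j := coprod.map l.j l'.j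
  r := coprod.map l.r l'.r
  w := coprod.map l.w l'.w
  isCofiberSeq := l.isCofiberSeq.coprod_map l'.isCofiberSeq
  weq_w := weq_coprod_map l.weq_w l'.weq_w

theorem red_coprod {A B X A' B' X' : C} (l : WeakCofiberSequence A B X)
    (l' : WeakCofiberSequence A' B' X') :
    (l.coprod l').red = l.red + l'.red + sumRed B B' - sumRed A A' - sumRed X X' := by
  have h : (l.coprod l').red = cofRed _ _ (l.isCofiberSeq.coprod_map l'.isCofiberSeq) +
    weqRed _ (weq_coprod_map l.weq_w l'.weq_w) := red_eq _
  rw [h, red_eq, red_eq, cofRed_coprod_map l.isCofiberSeq l'.isCofiberSeq,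
    weqRed_coprod_map l.weq_w l'.weq_w]
  abel

/-- Transport of a weak cofiber sequence along an isomorphism of the middle object. -/
def compIso {A B X : C} (l : WeakCofiberSequence A B X) {B' : C} (θ : B ≅ B') :
    WeakCofiberSequence A B' X where
  X₁ := l.X₁
  j := l.j ≫ θ.hom
  r := θ.inv ≫ l.r
  w := l.w
  isCofiberSeq := l.isCofiberSeq.comp_iso θ
  weq_w := l.weq_w

/-- The isomorphism induces identities on the first and third objects. The formula holds in `𝒟₁ C`
itself, as the final twist by a symmetry requires. -/
theorem toD₁_compIso {A B X : C} (l : WeakCofiberSequence A B X) {B' : C} (θ : B ≅ B') :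
    (l.compIso θ).toD₁ = weqClass θ.hom (weq_iso θ) + l.toD₁ := by
  have k := cofSeqClass_weq l.isCofiberSeq (l.isCofiberSeq.comp_iso θ) (weq_id A) (weq_iso θ)
    (weq_id _) (by simp) (by simp)
  rw [weqClass_id, weqClass_id, act_zero_left, add_zero, add_assoc, eq_comm,
    neg_add_eq_zero] at k
  rw [toD₁, toD₁, ← add_assoc, ← k]
  rfl

/-- The weak cofiber sequence given by a cofiber sequence. -/
def ofCofiberSeq {A B Q : C} (i : A ⟶ B) (q : B ⟶ Q) (h : IsCofiberSeq i q) :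
    WeakCofiberSequence A B Q where
  X₁ := Q
  j := i
  r := q
  w := 𝟙 Q
  isCofiberSeq := h
  weq_w := weq_id Q

@[simp]
theorem toD₁_ofCofiberSeq {A B Q : C} (i : A ⟶ B) (q : B ⟶ Q) (h : IsCofiberSeq i q) :
    (ofCofiberSeq i q h).toD₁ = cofSeqClass i q h := by
  simp [toD₁, ofCofiberSeq]

theorem red_ofCofiberSeq {A B Q : C} (i : A ⟶ B) (q : B ⟶ Q) (h : IsCofiberSeq i q) :
    (ofCofiberSeq i q h).red = cofRed i q h := by
  rw [red, toD₁_ofCofiberSeq, cofRed]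

/-- The weak cofiber sequence `* ⟶ A' ⟶ A' ⟵ A` given by a weak equivalence `A ⟶ A'`. -/
noncomputable def ofWeq {A A' : C} (f : A ⟶ A') (hf : weq f) :
    WeakCofiberSequence zeroObj A' A where
  X₁ := A'
  j := fromZero A'
  r := 𝟙 A'
  w := f
  isCofiberSeq := isCofiberSeq_fromZero_id A'
  weq_w := hf

@[simp]
theorem toD₁_ofWeq {A A' : C} (f : A ⟶ A') (hf : weq f) : (ofWeq f hf).toD₁ = weqClass f hf := by
  simp [toD₁, ofWeq]

theorem red_ofWeq {A A' : C} (f : A ⟶ A') (hf : weq f) : (ofWeq f hf).red = weqRed f hf := by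
  rw [red, toD₁_ofWeq, weqRed]

end WeakCofiberSequence

end ReducedClasses

end WaldhausenCategory

/-! ### Formal sums of objects and the decomposition modulo brackets. -/

namespace WaldhausenCategory

open StableQuadraticModule

section FormalSums
variable {C : Type u} [Category.{v} C] [WaldhausenCategory C]

attribute [local simp] coprod.inl_desc coprod.inr_desc coprod.inl_desc_assoc coprod.inr_desc_assoc

/-- The coproduct of a bracketed nonempty list of objects. -/
noncomputable def sumObj : FreeAddMagma C → C
  | .of A => A
  | .add S T => sumObj S ⨿ sumObj T

/-- The class, modulo brackets, which compares the coproduct of a bracketed list of objects with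
the sum of their classes. -/
noncomputable def sumCompare : FreeAddMagma C → (D C).Reduced
  | .of _ => 0
  | .add S T => sumCompare S + sumCompare T + sumRed (sumObj S) (sumObj T)

theorem sumObj_add (S T : FreeAddMagma C) : sumObj (S + T) = (sumObj S ⨿ sumObj T) := rfl

theorem sumCompare_add (S T : FreeAddMagma C) :
    sumCompare (S + T) = sumCompare S + sumCompare T + sumRed (sumObj S) (sumObj T) := rfl

/-- Two bracketed lists of objects are equivalent if there is an isomorphism between their
coproducts whose class is the difference of the comparison classes. -/
def SumEquiv (S T : FreeAddMagma C) : Prop :=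
  ∃ θ : sumObj S ≅ sumObj T, weqRed θ.hom (weq_iso θ) = sumCompare T - sumCompare S

namespace SumEquiv

theorem refl (S : FreeAddMagma C) : SumEquiv S S :=
  ⟨Iso.refl _, (weqRed_id _ _).trans (sub_self _).symm⟩

theorem symm {S T : FreeAddMagma C} : SumEquiv S T → SumEquiv T S := by
  rintro ⟨θ, h⟩
  refine ⟨θ.symm, (weqRed_iso_inv θ (weq_iso θ.symm) (weq_iso θ)).trans ?_⟩
  rw [h, neg_sub]

theorem trans {R S T : FreeAddMagma C} : SumEquiv R S → SumEquiv S T → SumEquiv R T := by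
  rintro ⟨θ, h⟩ ⟨η, k⟩
  refine ⟨θ ≪≫ η, (weqRed_comp θ.hom η.hom (weq_iso θ) (weq_iso η) _).trans ?_⟩
  rw [h, k]
  abel

theorem add {S T S' T' : FreeAddMagma C} :
    SumEquiv S T → SumEquiv S' T' → SumEquiv (S + S') (T + T') := by
  rintro ⟨θ, h⟩ ⟨η, k⟩
  refine ⟨coprod.mapIso θ η, (weqRed_coprod_map (weq_iso θ) (weq_iso η) _).trans ?_⟩
  rw [h, k, sumCompare_add, sumCompare_add]
  abel

theorem add_comm (S T : FreeAddMagma C) : SumEquiv (S + T) (T + S) := by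
  refine ⟨coprod.braiding _ _, (weqRed_braiding _ _ _).trans ?_⟩
  rw [sumCompare_add, sumCompare_add]
  abel

theorem add_assoc (R S T : FreeAddMagma C) : SumEquiv (R + S + T) (R + (S + T)) := by
  refine ⟨coprod.associator _ _ _, (weqRed_associator _ _ _ _).trans ?_⟩
  rw [sumCompare_add, sumCompare_add, sumCompare_add, sumCompare_add, sumObj_add, sumObj_add]
  abel

theorem zeroObj_add (T : FreeAddMagma C) : SumEquiv (.of zeroObj + T) T := by
  refine ⟨zeroCoprodIso _, (weqRed_zeroCoprodIso _ _).trans ?_⟩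
  rw [sumCompare_add, sumObj, sumCompare]
  abel

end SumEquiv

variable (C) in
/-- The congruence `SumEquiv`. -/
def sumCon : AddCon (FreeAddMagma C) where
  r := SumEquiv
  iseqv := ⟨SumEquiv.refl, SumEquiv.symm, SumEquiv.trans⟩
  add' := SumEquiv.add

noncomputable instance : Zero (sumCon C).Quotient :=
  ⟨((.of zeroObj : FreeAddMagma C) : (sumCon C).Quotient)⟩

noncomputable instance : AddCommMonoid (sumCon C).Quotient where
  add_assoc := by
    rintro ⟨R⟩ ⟨S⟩ ⟨T⟩
    exact (AddCon.eq (sumCon C)).2 (SumEquiv.add_assoc R S T)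
  nsmul := nsmulRec
  zero_add := by
    rintro ⟨T⟩
    exact (AddCon.eq (sumCon C)).2 (SumEquiv.zeroObj_add T)
  add_zero := by
    rintro ⟨T⟩
    exact (AddCon.eq (sumCon C)).2 ((SumEquiv.add_comm _ _).trans (SumEquiv.zeroObj_add T))
  add_comm := by
    rintro ⟨S⟩ ⟨T⟩
    exact (AddCon.eq (sumCon C)).2 (SumEquiv.add_comm S T)

open Classical in
/-- The multiset of nonzero objects given by a bracketed list of objects. -/
noncomputable def sumCount : FreeAddMagma C → C →₀ ℕ
  | .of A => if A = zeroObj then 0 else Finsupp.single A 1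
  | .add S T => sumCount S + sumCount T

/-- Formal sums modulo `SumEquiv` form a commutative monoid with unit the class of `*`. The quotient
map therefore factors through the free commutative monoid on the objects, by way of `sumCount`. -/
theorem sumEquiv_of_sumCount_eq {S T : FreeAddMagma C} (h : sumCount S = sumCount T) :
    SumEquiv S T := by
  let F : (C →₀ ℕ) →+ (sumCon C).Quotient :=
    Finsupp.liftAddHom fun A => multiplesHom _ ((.of A : FreeAddMagma C) : (sumCon C).Quotient)
  have hF (T : FreeAddMagma C) : F (sumCount T) = (T : (sumCon C).Quotient) := by
    induction T with
    | ih1 A =>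
      rw [sumCount]
      split_ifs with hA
      · rw [map_zero, hA]
        rfl
      · simp [F]
    | ih2 S T hS hT => exact (map_add F _ _).trans (congrArg₂ _ hS hT)
  exact (AddCon.eq (sumCon C)).1 ((hF S).symm.trans ((congrArg F h).trans (hF T)))

/-- Every element of `𝒟₁ C` is, modulo brackets, the difference of two weak cofiber sequences
whose first and fourth objects agree, up to comparison classes. -/
theorem exists_red_eq (x : (D C).C₁) :
    ∃ (S T : FreeAddMagma C) (A X : C) (l₁ : WeakCofiberSequence A (sumObj S) X)
      (l₂ : WeakCofiberSequence A (sumObj T) X),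
      (D C).toReduced x = -l₁.red + l₂.red + sumCompare S - sumCompare T := by
  induction x using D.induction_on with
  | zero =>
    let l := WeakCofiberSequence.ofWeq (𝟙 (zeroObj (C := C))) (weq_id _)
    exact ⟨.of zeroObj, .of zeroObj, _, _, l, l, by simp⟩
  | weq f hf =>
    rename_i A A'
    have e : (D C).toReduced (weqClass f hf) =
        -(WeakCofiberSequence.ofWeq (𝟙 A) (weq_id A)).red +
          (WeakCofiberSequence.ofWeq f hf).red + 0 - 0 := by
      simp [WeakCofiberSequence.red_ofWeq, weqRed]
    exact ⟨.of A, .of A', _, _, _, _, e⟩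
  | cofSeq i q h =>
    rename_i A B Q
    -- The split sequence has the same first and fourth objects as the given one, and its class
    -- cancels against the comparison class of `A + Q`.
    refine ⟨.of A + .of Q, .of B, A, Q, .ofCofiberSeq _ _ (isCofiberSeq_inl A Q),
      .ofCofiberSeq i q h, ?_⟩
    have e₁ := WeakCofiberSequence.red_ofCofiberSeq _ _ (isCofiberSeq_inl A Q)
    have e₂ := WeakCofiberSequence.red_ofCofiberSeq i q h
    refine Eq.trans ?_ (congrArg₂ (fun a b => -a + b + sumCompare (.of A + .of Q) -
      sumCompare (.of B)) e₁ e₂).symm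
    rw [sumCompare_add, ← sumRed_def, cofRed]
    change _ = -sumRed A Q + _ + (0 + 0 + sumRed A Q) - 0
    abel
  | bracket a b =>
    let l := WeakCofiberSequence.ofWeq (𝟙 (zeroObj (C := C))) (weq_id _)
    exact ⟨.of zeroObj, .of zeroObj, _, _, l, l, by simp⟩
  | neg x hx =>
    obtain ⟨S, T, A, X, l₁, l₂, h⟩ := hx
    refine ⟨T, S, A, X, l₂, l₁, ?_⟩
    rw [map_neg, h]
    abel
  | add x y hx hy =>
    obtain ⟨S, T, A, X, l₁, l₂, h⟩ := hx
    obtain ⟨S', T', A', X', l₁', l₂', h'⟩ := hy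
    -- The corrections for the first and fourth objects agree on both sides and cancel; those for
    -- the middle objects are absorbed by the comparison classes of `S + S'` and `T + T'`.
    refine ⟨S + S', T + T', A ⨿ A', X ⨿ X', l₁.coprod l₁', l₂.coprod l₂', ?_⟩
    have e₁ := l₁.red_coprod l₁'
    have e₂ := l₂.red_coprod l₂'
    refine Eq.trans ?_ (congrArg₂ (fun a b => -a + b + sumCompare (S + S') -
      sumCompare (T + T')) e₁ e₂).symm
    rw [map_add, h, h', sumCompare_add, sumCompare_add]
    abel

end FormalSums

end WaldhausenCategory

/-! ### Central extensions with biadditive cocycle. -/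

/-- The central extension of `P` by `Z` with cocycle a biadditive map `β`. -/
@[ext]
structure BiadditiveExtension {P : Type u₀} {Z : Type u₁} [AddCommGroup P] [AddCommGroup Z]
    (β : P →+ P →+ Z) : Type (max u₀ u₁) where
  fst : P
  snd : Z

namespace BiadditiveExtension

section
variable {P : Type u₀} {Z : Type u₁} [AddCommGroup P] [AddCommGroup Z] {β : P →+ P →+ Z}

instance : Zero (BiadditiveExtension β) := ⟨⟨0, 0⟩⟩
instance : Add (BiadditiveExtension β) :=
  ⟨fun x y => ⟨x.fst + y.fst, x.snd + y.snd + β x.fst y.fst⟩⟩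
instance : Neg (BiadditiveExtension β) := ⟨fun x => ⟨-x.fst, -x.snd + β x.fst x.fst⟩⟩

@[simp] theorem fst_zero : (0 : BiadditiveExtension β).fst = 0 := rfl
@[simp] theorem snd_zero : (0 : BiadditiveExtension β).snd = 0 := rfl
@[simp] theorem fst_add (x y : BiadditiveExtension β) : (x + y).fst = x.fst + y.fst := rfl
@[simp] theorem snd_add (x y : BiadditiveExtension β) :
    (x + y).snd = x.snd + y.snd + β x.fst y.fst := rfl
@[simp] theorem fst_neg (x : BiadditiveExtension β) : (-x).fst = -x.fst := rfl
@[simp] theorem snd_neg (x : BiadditiveExtension β) : (-x).snd = -x.snd + β x.fst x.fst := rfl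

instance : AddGroup (BiadditiveExtension β) :=
  AddGroup.ofLeftAxioms
    (fun x y z => by ext <;> simp [map_add, AddMonoidHom.add_apply]; abel; abel)
    (fun x => by ext <;> simp)
    (fun x => by ext <;> simp)

theorem addComm_eq (x y : BiadditiveExtension β) :
    addComm x y = ⟨0, β x.fst y.fst - β y.fst x.fst⟩ := by
  ext <;> simp [addComm]
  abel

/-- The projection to the quotient. -/
def fstHom : BiadditiveExtension β →+ P where
  toFun := fst
  map_zero' := rfl
  map_add' _ _ := rfl

variable (β) in
/-- The identity homomorphism of a biadditive extension is a stable quadratic module. -/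
def stableQuadraticModule : StableQuadraticModule.{max u₀ u₁, max u₀ u₁} where
  C₀ := BiadditiveExtension β
  C₁ := BiadditiveExtension β
  bracket a b := addComm b a
  bracket_add_left a b c := by
    simp only [addComm_eq]
    ext <;> simp
    abel
  bracket_add_right a b c := by
    simp only [addComm_eq]
    ext <;> simp
    abel
  bd := AddMonoidHom.id _
  bd_bracket _ _ := rfl
  bracket_bd _ _ := rfl
  bracket_antisymm a b := by
    simp only [addComm_eq]
    ext <;> simp

end

end BiadditiveExtension

/-! ### Homomorphisms out of `𝒟₀ C`, and representation modulo brackets. -/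

namespace WaldhausenCategory

open StableQuadraticModule

section
variable {C : Type u} [Category.{v} C] [WaldhausenCategory C]

/-- A function from objects to a biadditive extension which vanishes on the distinguished zero
object extends to `𝒟₀ C`. -/
theorem exists_hom_biadditiveExtension {P : Type u₀} {Z : Type u₁} [AddCommGroup P]
    [AddCommGroup Z] (β : P →+ P →+ Z) (o : C → BiadditiveExtension β) (ho : o zeroObj = 0) :
    ∃ f : (D C).C₀ →+ BiadditiveExtension β, ∀ A, f (objClass A) = o A := by
  let M := BiadditiveExtension.stableQuadraticModule β
  let g₀ : C → M.C₀ := o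
  -- The boundary of `M` is the identity, so these values are forced. Every relation then becomes a
  -- group identity, using only that `o` kills `*`.
  let g₁ : Gen₁ C → M.C₁
    | @Gen₁.weq _ _ _ A A' _ _ => (-o A' + o A : BiadditiveExtension β)
    | @Gen₁.cofSeq _ _ _ A B Q _ _ _ => (-o B + o Q + o A : BiadditiveExtension β)
  have e₀ (A : C) : eval₀ g₀ g₁ (wObj A) = o A := by
    simp only [eval₀, wObj, Word₀.gen, FreeAddGroup.lift_apply_of]
    rfl
  have ew {A A' : C} (f : A ⟶ A') (hf : weq f) :
      eval₁ g₀ g₁ (wWeq f hf) = (-o A' + o A : BiadditiveExtension β) := by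
    simp only [eval₁, wWeq, Word₁.gen, FreeAddGroup.lift_apply_of]
    rfl
  have ec {A B Q : C} (i : A ⟶ B) (q : B ⟶ Q) (h : IsCofiberSeq i q) :
      eval₁ g₀ g₁ (wCof i q h) = (-o B + o Q + o A : BiadditiveExtension β) := by
    simp only [eval₁, wCof, Word₁.gen, FreeAddGroup.lift_apply_of]
    rfl
  let ev : Word₁ C (Gen₁ C) →+ BiadditiveExtension β := eval₁ g₀ g₁
  have ea (w : Word₁ C (Gen₁ C)) (A : C) :
      eval₁ g₀ g₁ (Word₁.act w (wObj A)) = -o A + ev w + o A := by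
    rw [Word₁.act, map_add, eval₁_bracket, ← bd_eval₁, e₀]
    change ev w + (-ev w + -o A + ev w + o A) = -o A + ev w + o A
    simp only [add_assoc, add_neg_cancel_left]
  have evw {A A' : C} (f : A ⟶ A') (hf : weq f) : ev (wWeq f hf) = -o A' + o A := ew f hf
  have evc {A B Q : C} (i : A ⟶ B) (q : B ⟶ Q) (h : IsCofiberSeq i q) :
      ev (wCof i q h) = -o B + o Q + o A := ec i q h
  have h₀ (a b) (h : DRel₀ (C := C) a b) : eval₀ g₀ g₁ a = eval₀ g₀ g₁ b := by
    cases h with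
    | bd_weq f hf =>
      rw [← bd_eval₁, ew, map_add, map_neg, e₀, e₀]
      rfl
    | bd_cofSeq i q h =>
      rw [← bd_eval₁, ec, map_add, map_add, map_neg, e₀, e₀, e₀]
      rfl
    | zero => rw [e₀, ho, map_zero]; rfl
  have h₁ (x y) (h : DRel₁ (C := C) x y) : eval₁ g₀ g₁ x = eval₁ g₀ g₁ y := by
    cases h with
    | weq_id A =>
      rw [ew, map_zero]
      exact neg_add_cancel _
    | cofSeq_id_toZero A =>
      rw [ec, map_zero, ho, add_zero]
      exact neg_add_cancel _
    | cofSeq_fromZero_id A =>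
      rw [ec, map_zero, ho, add_zero]
      exact neg_add_cancel _
    | weq_comp f g hf hg =>
      rename_i A B X
      rw [map_add, ew, ew, ew]
      change (_ : BiadditiveExtension β) = (-o X + o B) + (-o B + o A)
      simp [add_assoc]
    | cofSeq_weq i q i' q' h h' a b c ha hb hc comm₁ comm₂ =>
      rename_i A B Q A' B' Q'
      rw [map_add, map_add, map_add, map_neg, ea, evw, ew, ew, ec, ec]
      change ((-o A' + o A) + (-o A + (-o Q' + o Q) + o A) : BiadditiveExtension β) =
        -(-o B' + o Q' + o A') + (-o B' + o B) + (-o B + o Q + o A)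
      simp [add_assoc]
    | cofSeq_comp i j p r k s comm hAB hAX hBX hPR =>
      rename_i A B X P R S
      rw [map_add, map_add, ea, evc, ec, ec, ec]
      change ((-o X + o S + o B) + (-o B + o P + o A) : BiadditiveExtension β) =
        (-o X + o R + o A) + (-o A + (-o R + o S + o P) + o A)
      simp [add_assoc]
    | coproduct i₁ i₂ p₁ p₂ h =>
      rename_i A B S
      rw [eval₁_bracket, map_add, map_neg, e₀, e₀, ec, ec]
      change (-o B + -o A + o B + o A : BiadditiveExtension β) =
        -(-o S + o A + o B) + (-o S + o B + o A)
      simp [add_assoc]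
  obtain ⟨F, ⟨hF, -⟩, -⟩ := presented_universal g₀ g₁ h₀ h₁
  exact ⟨F.f₀, hF⟩

/-- The generator of `ℤ[Ob C]` given by an object, or zero for the distinguished zero object. -/
noncomputable def objSingle (A : C) : C →₀ ℤ := (sumCount (.of A)).mapRange Nat.cast Nat.cast_zero

@[simp]
theorem objSingle_zeroObj : objSingle (zeroObj (C := C)) = 0 := by
  simp [objSingle, sumCount]

/-- If `∂ x = 0`, then the bracketed lists in the decomposition of `x` are equivalent. -/
theorem sumEquiv_of_red_eq {x : (D C).C₁} (hx : (D C).bd x = 0) {S T : FreeAddMagma C} {A X : C}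
    (l₁ : WeakCofiberSequence A (sumObj S) X) (l₂ : WeakCofiberSequence A (sumObj T) X)
    (h : (D C).toReduced x = -l₁.red + l₂.red + sumCompare S - sumCompare T) : SumEquiv S T := by
  -- With zero cocycle the first projection is all that matters: `f` counts objects.
  obtain ⟨f', hf'⟩ := exists_hom_biadditiveExtension (0 : (C →₀ ℤ) →+ (C →₀ ℤ) →+ (C →₀ ℤ))
    (fun A => ⟨objSingle A, 0⟩) (by rw [objSingle_zeroObj]; rfl)
  let f : (D C).C₀ →+ (C →₀ ℤ) := BiadditiveExtension.fstHom.comp f'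
  have hf (A : C) : f (objClass A) = objSingle A := congrArg BiadditiveExtension.fst (hf' A)
  have hb : (D C).bracketSubgroup ≤ (f.comp (D C).bd).ker := by
    refine (AddSubgroup.closure_le _).2 ?_
    rintro _ ⟨a, b, rfl⟩
    change f ((D C).bd _) = 0
    rw [(D C).bd_bracket, addComm, map_add, map_add, map_add, map_neg, map_neg]
    abel
  let ρ : (D C).Reduced →+ (C →₀ ℤ) := QuotientAddGroup.lift _ (f.comp (D C).bd) hb
  have hρ (y : (D C).C₁) : ρ ((D C).toReduced y) = f ((D C).bd y) := rfl
  -- The boundary of a comparison class is the sum of the entries minus the class of their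
  -- coproduct.
  have hs (T : FreeAddMagma C) : ρ (sumCompare T) =
      (sumCount T).mapRange Nat.cast Nat.cast_zero - f (objClass (sumObj T)) := by
    induction T with
    | ih1 A => rw [sumCompare, sumObj, hf, objSingle, sub_self, map_zero]
    | ih2 S T hS hT =>
      have e : sumCount (S + T) = sumCount S + sumCount T := rfl
      rw [sumCompare_add, map_add, map_add, hS, hT, e, Finsupp.mapRange_add Nat.cast_add, sumRed,
        cofRed, hρ, bd_cofSeqClass, sumObj_add, map_add, map_add, map_neg]
      abel
  have key := congrArg ρ h
  rw [hρ, hx, map_zero, map_sub, map_add, map_add, map_neg, hs, hs, WeakCofiberSequence.red,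
    WeakCofiberSequence.red, hρ, hρ, WeakCofiberSequence.bd_toD₁, WeakCofiberSequence.bd_toD₁,
    map_add, map_add, map_add, map_add, map_neg, map_neg] at key
  -- In `key` the terms of `A` and `X` cancel, as do those of the two coproducts, leaving the
  -- difference of the two counts.
  refine sumEquiv_of_sumCount_eq (Finsupp.mapRange_injective _ Nat.cast_zero Nat.cast_injective
    (sub_eq_zero.1 (Eq.trans ?_ key.symm)))
  abel

/-- Modulo brackets, every element of `K₁ C` is represented by a pair of weak cofiber sequences. -/
theorem exists_pair_add (x : (D C).C₁) (hx : (D C).bd x = 0) :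
    ∃ (P : PairOfWeakCofiberSequences C) (y : (D C).C₁), y ∈ (D C).bracketSubgroup ∧
      (D C).bd y = 0 ∧ (P.toK₁ : (D C).C₁) + y = x := by
  obtain ⟨S, T, A, X, l₁, l₂, h⟩ := exists_red_eq x
  obtain ⟨θ, hθ⟩ := sumEquiv_of_red_eq hx l₁ l₂ h
  -- Transport along `θ` gives `l₁` the middle object of `l₂`, and the class of `θ` accounts for the
  -- comparison terms.
  let P : PairOfWeakCofiberSequences C := ⟨A, sumObj T, X, l₁.compIso θ, l₂⟩
  have hP : (D C).toReduced P.toK₁ = (D C).toReduced x := by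
    change (D C).toReduced (-(l₁.compIso θ).toD₁ + l₂.toD₁) = _
    rw [h, map_add, map_neg, WeakCofiberSequence.toD₁_compIso, map_add]
    change -(weqRed _ _ + l₁.red) + l₂.red = _
    rw [hθ]
    abel
  refine ⟨P, -P.toK₁ + x, ((D C).toReduced_eq_iff _ _).1 hP, ?_, add_neg_cancel_left _ _⟩
  have hK : (D C).bd P.toK₁ = 0 := P.toK₁.2
  rw [map_add, map_neg, hK, hx, neg_zero, add_zero]

end

end WaldhausenCategory

/-! ### The homomorphism `a ↦ ⟨a, a⟩`. -/

namespace StableQuadraticModule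

section
variable (M : StableQuadraticModule.{u₀, u₁})

instance : AddCommGroup (AddSubgroup.center M.C₁) :=
  { (inferInstance : AddGroup (AddSubgroup.center M.C₁)) with
    add_comm := fun x y => Subtype.ext (AddSubgroup.mem_center_iff.1 y.2 x.1) }

/-- The bracket with values in the center of `C₁`. -/
def centralBracket (a b : M.C₀) : AddSubgroup.center M.C₁ :=
  ⟨M.bracket a b, M.bracketSubgroup_le_center (AddSubgroup.subset_closure ⟨a, b, rfl⟩)⟩

theorem centralBracket_antisymm (a b : M.C₀) :
    M.centralBracket a b + M.centralBracket b a = 0 :=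
  Subtype.ext (M.bracket_antisymm a b)

/-- The homomorphism `a ↦ ⟨a, a⟩`. -/
def square : M.C₀ →+ AddSubgroup.center M.C₁ where
  toFun a := M.centralBracket a a
  map_zero' := Subtype.ext (M.bracket_zero_left 0)
  map_add' a b := by
    have h : M.centralBracket (a + b) (a + b) =
        M.centralBracket a a + M.centralBracket a b +
          (M.centralBracket b a + M.centralBracket b b) :=
      Subtype.ext (by
        change M.bracket _ _ = M.bracket _ _ + M.bracket _ _ + (M.bracket _ _ + M.bracket _ _)
        rw [M.bracket_add_left, M.bracket_add_right, M.bracket_add_right])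
    -- Antisymmetry cancels the cross terms.
    rw [h, ← sub_eq_zero, ← M.centralBracket_antisymm a b]
    abel

theorem square_bd (x : M.C₁) : M.square (M.bd x) = 0 :=
  Subtype.ext ((M.bracket_bd x x).trans (by simp [addComm]))

theorem square_add_self (a : M.C₀) : M.square a + M.square a = 0 :=
  M.centralBracket_antisymm a a

end

end StableQuadraticModule

/-! ### Sums of brackets with trivial boundary. -/

namespace WaldhausenCategory

open StableQuadraticModule

section
variable {C : Type u} [Category.{v} C] [WaldhausenCategory C]

/-- `square` vanishes on boundaries, in particular on that of the split sequence. Hence sums of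
squares of objects are again squares of objects. -/
theorem square_objClass_coprod (A B : C) : (D C).square (objClass (A ⨿ B)) =
    (D C).square (objClass A) + (D C).square (objClass B) := by
  have h := (D C).square_bd (cofSeqClass _ _ (isCofiberSeq_inl A B))
  rw [bd_cofSeqClass, map_add, map_add, map_neg, add_assoc, neg_add_eq_zero] at h
  rw [h, add_comm]

/-- A sum of brackets in the kernel of `∂` is of the form `⟨[A], [A]⟩`. -/
theorem eq_bracket_self_of_bd_eq_zero {y : (D C).C₁} (hy : y ∈ (D C).bracketSubgroup)
    (h : (D C).bd y = 0) : ∃ A : C, y = (D C).bracket (objClass A) (objClass A) := by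
  classical
  -- The order keeps one half of the antisymmetric bracket, so that antisymmetrizing `b` returns the
  -- full bracket off the diagonal.
  let b (X Y : C) : AddSubgroup.center (D C).C₁ :=
    if WellOrderingRel X Y then (D C).centralBracket (objClass Y) (objClass X) else 0
  let β : (C →₀ ℤ) →+ (C →₀ ℤ) →+ AddSubgroup.center (D C).C₁ :=
    Finsupp.liftAddHom fun X => zmultiplesHom _
      (Finsupp.liftAddHom fun Y => zmultiplesHom _ (b X Y))
  have hz (X : C) : b zeroObj X = 0 := by
    simp only [b]
    split_ifs
    · exact Subtype.ext (by
        have := (D C).bracket_antisymm (objClass X) 0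
        rw [bracket_zero_left, add_zero] at this
        simpa [centralBracket] using this)
    · rfl
  have hz' (X : C) : b X zeroObj = 0 := by
    simp only [b]
    split_ifs
    · exact Subtype.ext (by simp [centralBracket, bracket_zero_left])
    · rfl
  have hβ (X Y : C) : β (objSingle X) (objSingle Y) = b X Y := by
    by_cases hX : X = zeroObj
    · subst hX
      simp [hz]
    by_cases hY : Y = zeroObj
    · subst hY
      simp [hz']
    simp [objSingle, sumCount, hX, hY, β]
  obtain ⟨f, hf⟩ := exists_hom_biadditiveExtension β (fun A : C => ⟨objSingle A, 0⟩)
    (by rw [objSingle_zeroObj]; rfl)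
  -- The central elements that `f` recovers from their boundary up to the square of an object.
  -- Closure under negation uses that squares are 2-torsion.
  let S : AddSubgroup (D C).C₁ :=
    { carrier := {y | ∃ (hy : y ∈ AddSubgroup.center (D C).C₁) (X : C),
        f ((D C).bd y) = ⟨0, ⟨y, hy⟩ + (D C).square (objClass X)⟩}
      zero_mem' := ⟨zero_mem _, zeroObj, by
        rw [map_zero, map_zero, objClass_zeroObj, map_zero]
        ext <;> simp⟩
      add_mem' := by
        rintro y y' ⟨hy, X, h⟩ ⟨hy', X', h'⟩
        refine ⟨add_mem hy hy', X ⨿ X', ?_⟩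
        rw [map_add, map_add, h, h', square_objClass_coprod,
          show (⟨y + y', add_mem hy hy'⟩ : AddSubgroup.center (D C).C₁) = ⟨y, hy⟩ + ⟨y', hy'⟩
            from rfl]
        apply BiadditiveExtension.ext
        · simp
        · simp only [BiadditiveExtension.snd_add, map_zero, add_zero]
          abel
      neg_mem' := by
        rintro y ⟨hy, X, h⟩
        refine ⟨neg_mem hy, X, ?_⟩
        rw [map_neg, map_neg, h,
          show (⟨-y, neg_mem hy⟩ : AddSubgroup.center (D C).C₁) = -⟨y, hy⟩ from rfl]
        apply BiadditiveExtension.ext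
        · simp
        · simp only [BiadditiveExtension.snd_neg, map_zero, add_zero, neg_add]
          rw [neg_eq_of_add_eq_zero_left ((D C).square_add_self _)] }
  have hobj (A B : C) : (D C).bracket (objClass A) (objClass B) ∈ S := by
    -- `∂` turns the bracket into a commutator, and commutators in the extension are computed by
    -- antisymmetrizing `β`.
    have e : f ((D C).bd ((D C).bracket (objClass A) (objClass B))) = ⟨0, b B A - b A B⟩ := by
      rw [(D C).bd_bracket, ← hβ, ← hβ]
      simp only [addComm, map_add, map_neg, hf]
      exact BiadditiveExtension.addComm_eq (β := β) ⟨objSingle B, 0⟩ ⟨objSingle A, 0⟩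
    refine ⟨((D C).centralBracket (objClass A) (objClass B)).2, ?_⟩
    change ∃ X, _ = BiadditiveExtension.mk 0
      ((D C).centralBracket (objClass A) (objClass B) + (D C).square (objClass X))
    rw [e]
    rcases trichotomous_of WellOrderingRel A B with hAB | rfl | hAB
    · refine ⟨zeroObj, ?_⟩
      rw [objClass_zeroObj, map_zero, add_zero]
      simp only [b, hAB, if_true, asymm_of WellOrderingRel hAB, if_false, zero_sub]
      rw [neg_eq_of_add_eq_zero_left ((D C).centralBracket_antisymm _ _)]
    -- On the diagonal `f` sees nothing; the defect `⟨[A], [A]⟩` is its own inverse, so `A` is the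
    -- witness.
    · refine ⟨A, ?_⟩
      rw [sub_self]
      exact congrArg _ ((D C).square_add_self (objClass A)).symm
    · refine ⟨zeroObj, ?_⟩
      rw [objClass_zeroObj, map_zero, add_zero]
      simp only [b, hAB, if_true, asymm_of WellOrderingRel hAB, if_false, sub_zero]
  have hS : (D C).bracketSubgroup ≤ S := by
    refine (AddSubgroup.closure_le _).2 ?_
    rintro _ ⟨a, c, rfl⟩
    induction a using D.induction_on₀ with
    | zero => rw [bracket_zero_left]; exact S.zero_mem
    | neg a h => rw [bracket_neg_left]; exact S.neg_mem h
    | add a a' h h' => rw [(D C).bracket_add_left]; exact S.add_mem h h'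
    | obj A =>
      have e (c : (D C).C₀) : (D C).bracket (objClass A) c = -(D C).bracket c (objClass A) :=
        eq_neg_of_add_eq_zero_left ((D C).bracket_antisymm _ _)
      induction c using D.induction_on₀ with
      | zero => rw [e, bracket_zero_left, neg_zero]; exact S.zero_mem
      | neg c h => rw [e, bracket_neg_left, ← e]; exact S.neg_mem h
      | add c c' h h' => rw [(D C).bracket_add_right]; exact S.add_mem h h'
      | obj B => exact hobj A B
  obtain ⟨hc, A, hA⟩ := hS hy
  refine ⟨A, ?_⟩
  -- As `∂ y = 0`, the sum of `y` and a 2-torsion square vanishes, so `y` is that square.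
  rw [h, map_zero] at hA
  have k := congrArg BiadditiveExtension.snd hA
  rw [BiadditiveExtension.snd_zero, eq_comm, ← (D C).square_add_self (objClass A),
    add_left_inj] at k
  exact congrArg Subtype.val k

end

end WaldhausenCategory

/-! ### Absorbing `⟨[A], [A]⟩` into a pair. -/

namespace WaldhausenCategory

open StableQuadraticModule

section
variable {C : Type u} [Category.{v} C] [WaldhausenCategory C]

attribute [local simp] coprod.inl_desc coprod.inr_desc coprod.inl_desc_assoc coprod.inr_desc_assoc

namespace WeakCofiberSequence

/-- The coproduct of a weak cofiber sequence with `* ⟶ Y ⟶ Y`. -/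
noncomputable def addQuotient {A B X : C} (l : WeakCofiberSequence A B X) (Y : C) :
    WeakCofiberSequence A (B ⨿ Y) (X ⨿ Y) where
  X₁ := l.X₁ ⨿ Y
  j := l.j ≫ coprod.inl
  r := coprod.map l.r (𝟙 Y)
  w := coprod.map l.w (𝟙 Y)
  isCofiberSeq := l.isCofiberSeq.comp_inl Y
  weq_w := weq_coprod_map l.weq_w (weq_id Y)

/-- The filtration `A ↣ B ↣ B ⨿ Y` gives the formula with `l.X₁` in place of `X`; naturality of the
split sequence along `l.w` corrects this. The two outer terms depend only on `A`, `B`, `X` and `Y`,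
so they are common to both members of a pair. -/
theorem toD₁_addQuotient {A B X : C} (l : WeakCofiberSequence A B X) (Y : C) :
    (l.addQuotient Y).toD₁ = cofSeqClass _ _ (isCofiberSeq_inl B Y) + l.toD₁ -
      act (cofSeqClass _ _ (isCofiberSeq_inl X Y)) (objClass A) := by
  have h1 := cofSeqClass_comp (by simp) rfl (by ext <;> simp) l.isCofiberSeq
    (l.isCofiberSeq.comp_inl Y) (isCofiberSeq_inl B Y) (isCofiberSeq_inl l.X₁ Y)
  have h2 := cofSeqClass_weq (isCofiberSeq_inl X Y) (isCofiberSeq_inl l.X₁ Y) l.weq_w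
    (weq_coprod_map l.weq_w (weq_id Y)) (weq_id Y) (by simp) (by ext <;> simp)
  rw [weqClass_id, act_zero_left, add_zero] at h2
  have h : (l.addQuotient Y).toD₁ = cofSeqClass _ _ (l.isCofiberSeq.comp_inl Y) +
    act (weqClass _ (weq_coprod_map l.weq_w (weq_id Y))) (objClass A) := rfl
  rw [h, toD₁, h2, act_add, act_add, act_neg, ← add_assoc, ← add_assoc, ← add_assoc, h1]
  simp only [add_assoc, add_neg_cancel_left]
  rw [← add_assoc, add_sub_cancel_right]

end WeakCofiberSequence

/-- The class of the automorphism `1 ⨿ τ` of `B ⨿ (A ⨿ A)`, where `τ` exchanges the summands. -/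
theorem weqClass_braiding_self (A B : C)
    (h : weq (coprod.mapIso (Iso.refl B) (coprod.braiding A A)).hom) :
    weqClass (coprod.mapIso (Iso.refl B) (coprod.braiding A A)).hom h =
      (D C).bracket (objClass A) (objClass A) := by
  have e := (D C).square_add_self (objClass A)
  have h1 := cofSeqClass_weq (isCofiberSeq_inl A A) (isCofiberSeq_inr A A) (weq_id A)
    (weq_iso (coprod.braiding A A)) (weq_id A) (by simp) (by ext <;> simp)
  have h2 := cofSeqClass_weq (isCofiberSeq_inr B (A ⨿ A)) (isCofiberSeq_inr B (A ⨿ A))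
    (weq_iso (coprod.braiding A A)) h (weq_id B) (by simp) (by ext <;> simp)
  have hτ : (D C).bd (weqClass (coprod.braiding A A).hom (weq_iso _)) = 0 := by
    rw [bd_weqClass, neg_add_cancel]
  have hb := bracket_objClass (isCoproductDiagram_coprod A A)
  rw [weqClass_id, act_zero_left, add_zero] at h1 h2
  rw [add_assoc, add_comm_of_bd_eq_zero hτ, ← add_assoc, ← hb] at h1
  -- The symmetry exchanges the two split sequences on `A ⨿ A`, so its class is `-⟨[A], [A]⟩`; the
  -- sign is immaterial by 2-torsion.
  have h3 : (D C).bracket (objClass A) (objClass A) =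
      weqClass (coprod.braiding A A).hom (weq_iso _) := by
    rw [← add_right_inj ((D C).bracket (objClass A) (objClass A)), ← h1]
    exact congrArg Subtype.val e
  -- Extending the symmetry by the identity of `B` conjugates its class, which is central.
  have h4 : cofSeqClass _ _ (isCofiberSeq_inr B (A ⨿ A)) +
      weqClass (coprod.braiding A A).hom (weq_iso _) =
      weqClass (coprod.mapIso (Iso.refl B) (coprod.braiding A A)).hom h +
        cofSeqClass _ _ (isCofiberSeq_inr B (A ⨿ A)) := by
    rw [h2, add_assoc, add_neg_cancel_left]
  rw [← add_comm_of_bd_eq_zero hτ, add_left_inj] at h4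
  rw [h3, h4]

/-- The elements represented by pairs of weak cofiber sequences are closed under the addition of
the elements `⟨[A], [A]⟩`. -/
theorem PairOfWeakCofiberSequences.exists_toK₁_eq_add (P : PairOfWeakCofiberSequences C) (A : C) :
    ∃ P' : PairOfWeakCofiberSequences C,
      (P'.toK₁ : (D C).C₁) = P.toK₁ + (D C).bracket (objClass A) (objClass A) := by
  -- Adjoining `A ⨿ A` to both sequences leaves the class of the pair unchanged; the twist of the
  -- second contributes `⟨[A], [A]⟩`.
  let P' : PairOfWeakCofiberSequences C := ⟨_, _, _, P.l₁.addQuotient (A ⨿ A),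
    (P.l₂.addQuotient (A ⨿ A)).compIso (coprod.mapIso (Iso.refl P.B) (coprod.braiding A A))⟩
  refine ⟨P', ?_⟩
  change -(P.l₁.addQuotient (A ⨿ A)).toD₁ + ((P.l₂.addQuotient (A ⨿ A)).compIso
    (coprod.mapIso (Iso.refl P.B) (coprod.braiding A A))).toD₁ = _
  have hK : (D C).bd P.toK₁ = 0 := P.toK₁.2
  have hP : (P.toK₁ : (D C).C₁) = -P.l₁.toD₁ + P.l₂.toD₁ := rfl
  rw [WeakCofiberSequence.toD₁_compIso, weqClass_braiding_self, ← add_assoc,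
    ← bracket_add_comm, add_assoc, ← bracket_add_comm, WeakCofiberSequence.toD₁_addQuotient,
    WeakCofiberSequence.toD₁_addQuotient, add_right_inj]
  generalize act (cofSeqClass _ _ (isCofiberSeq_inl P.X (A ⨿ A))) (objClass P.A) = z
  generalize cofSeqClass _ _ (isCofiberSeq_inl P.B (A ⨿ A)) = y
  -- The terms `y` cancel, and conjugation by `z` is harmless because the class of `P` is central.
  have e : -(y + P.l₁.toD₁ - z) + (y + P.l₂.toD₁ - z) = z + (P.toK₁ : (D C).C₁) + -z := by
    rw [hP]
    simp [sub_eq_add_neg, add_assoc]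
  rw [e, ← add_comm_of_bd_eq_zero hK, add_neg_cancel_right]

end

end WaldhausenCategory

/-- Every element of `K₁ C` is represented by a pair of weak cofiber sequences. -/
theorem theorem2p1 {C : Type u} [Category.{v} C] [WaldhausenCategory C]
    (x : WaldhausenCategory.K₁ C) :
    ∃ P : WaldhausenCategory.PairOfWeakCofiberSequences C, P.toK₁ = x := by
  obtain ⟨P, y, hy, hy₀, h⟩ := WaldhausenCategory.exists_pair_add x.1 x.2
  obtain ⟨A, rfl⟩ := WaldhausenCategory.eq_bracket_self_of_bd_eq_zero hy hy₀
  obtain ⟨P', h'⟩ := P.exists_toK₁_eq_add A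
  exact ⟨P', Subtype.ext (h'.trans h)⟩
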